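/- Let $G$ be a finite-dimensional real Lie group with unit $e$, Lie algebra $\mathfrak g$ and exponential map $\exp$. Let $\mathfrak D\colon G\to G$ be a difference operator, i.e. a smooth map with $\mathfrak D(gh)=\mathfrak D(g)\,g\,\mathfrak D(h)\,g^{-1}$ for all $g,h\in G$. Let $V$ be a finite-dimensional real vector space, $T\colon V\to V$ a linear map and $\Theta\colon G\to GL(V)$ a Lie group homomorphism with $$T(\Theta(g)u)+\Theta(g)u=\Theta(\mathfrak D(g)g)T(u)+\Theta(\mathfrak D(g)g)u\qquad(g\in G,\ u\in V).$$ Put $\Theta_{\mathfrak D}(g)=\Theta(\mathfrak D(g)g)$, $D=\mathfrak D_{*e}\colon\mathfrak g\to\mathfrak g$, $\theta=\Theta_{*e}\colon\mathfrak g\to\mathfrak{gl}(V)$ and $\theta_D(x)=\theta(x)+\theta(D(x))$. *Group side.* Let $C^n(G,V)$ be the space of smooth maps $\alpha\colon G^n\to V$ that vanish whenever some argument equals $e$, and let $d^\Theta\colon C^n(G,V)\to C^{n+1}(G,V)$, $$d^\Theta\alpha(g_1,\dots,g_{n+1})=\Theta(g_1)\alpha(g_2,\dots,g_{n+1})+\sum_{i=1}^n(-1)^i\alpha(g_1,\dots,g_ig_{i+1},\dots,g_{n+1})+(-1)^{n+1}\alpha(g_1,\dots,g_n);$$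 $d^{\Theta_{\mathfrak D}}$ is defined likewise from $\Theta_{\mathfrak D}$. Define $\mathfrak K\colon C^n(G,V)\to C^n(G,V)$, $n\ge1$, by $\mathfrak K(\alpha)=p(\alpha)+h(\alpha)$ with $$h(\alpha)(g_1,\dots,g_n)=(-1)^n\big(\alpha(\mathfrak D(g_1)g_1,\dots,\mathfrak D(g_n)g_n)-T(\alpha(g_1,\dots,g_n))-\alpha(g_1,\dots,g_n)\big),$$ $p(\alpha)(g_1)=-\Theta(\mathfrak D(g_1))\alpha(g_1)+\alpha(\mathfrak D(g_1)g_1)-\alpha(\mathfrak D(g_1))$ for $n=1$, $p(\alpha)(g_1,g_2)=\alpha(\mathfrak D(g_1),g_1)-\alpha(\mathfrak D(g_1g_2),g_1g_2)+\Theta(\mathfrak D(g_1)g_1)\alpha(\mathfrak D(g_2),g_2)$ for $n=2$, and $p(\alpha)=0$ for $n\ge3$. Let $C^1(G,\mathfrak D,V,T)=C^1(G,V)$ and $C^n(G,\mathfrak D,V,T)=C^n(G,V)\oplus C^{n-1}(G,V)$ for $n\ge2$, with coboundary operator $\delta(\alpha_n,\beta_{n-1})=(d^\Theta\alpha_n,\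 d^{\Theta_{\mathfrak D}}\beta_{n-1}+\mathfrak K(\alpha_n))$ (where $\beta_0=0$ and $d^{\Theta_{\mathfrak D}}\beta_0=0$). Its cohomology in degree $n\ge1$ (cocycles modulo coboundaries; there are no non-zero coboundaries in degree $1$) is denoted $\mathcal H^n(G,\mathfrak D,V,T)$. *Lie algebra side.* Let $C^n(\mathfrak g,V)=\operatorname{Hom}(\wedge^n\mathfrak g,V)$, let $d^\theta,d^{\theta_D}$ be the Chevalley–Eilenberg coboundary operators with coefficients in $(V,\theta)$ and $(V,\theta_D)$, and let $K\colon C^n(\mathfrak g,V)\to C^n(\mathfrak g,V)$, $$K(\zeta)(x_1,\dots,x_n)=(-1)^n\Big(\sum_{\emptyset\ne S\subseteq\{1,\dots,n\}}\zeta(x_1^S,\dots,x_n^S)-T(\zeta(x_1,\dots,x_n))\Big),$$ where $x_i^S=D(x_i)$ for $i\in S$ and $x_i^S=x_i$ for $i\notin S$. Let $C^1(\mathfrak g,D,V,T)=C^1(\mathfrak g,V)$ and $C^n(\mathfrak g,D,V,T)=C^n(\mathfrak g,V)\oplus C^{n-1}(\mathfrak g,V)$ for $n\ge2$, with $\delta_\theta(\zeta_n,\xi_{n-1})=(d^\theta\zeta_n,\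 d^{\theta_D}\xi_{n-1}+K(\zeta_n))$ (where $\xi_0=0$ and $d^{\theta_D}\xi_0=0$), and cohomology $H^n(\mathfrak g,D,V,T)$, $n\ge1$. *Theorem.* The formula $$\mathrm{VE}_n(\alpha)(x_1,\dots,x_n)=\sum_{\epsilon\in S_n}(-1)^{|\epsilon|}\frac{d}{dt_{\epsilon(1)}}\cdots\frac{d}{dt_{\epsilon(n)}}\bigg|_{t_1=\cdots=t_n=0}\alpha\big(\exp(t_{\epsilon(1)}x_{\epsilon(1)}),\dots,\exp(t_{\epsilon(n)}x_{\epsilon(n)})\big)$$ defines linear maps $\mathrm{VE}_n\colon C^n(G,V)\to C^n(\mathfrak g,V)$, which satisfy $\mathrm{VE}_n\circ\mathfrak K=K\circ\mathrm{VE}_n$ for all $n\ge1$. The maps $$\widetilde{\mathrm{VE}}_n\colon C^n(G,\mathfrak D,V,T)\to C^n(\mathfrak g,D,V,T),\qquad \widetilde{\mathrm{VE}}_n(\alpha_n,\beta_{n-1})=(\mathrm{VE}_n\alpha_n,\mathrm{VE}_{n-1}\beta_{n-1}),\quad n\ge1$$ (with $\mathrm{VE}_0\beta_0=0$), form a cochain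 map: $\widetilde{\mathrm{VE}}_{n+1}\circ\delta=\delta_\theta\circ\widetilde{\mathrm{VE}}_n$ for all $n\ge1$. Consequently, for every $n\ge1$ there is a well-defined homomorphism $\widetilde{\mathrm{VE}}_{n*}\colon\mathcal H^n(G,\mathfrak D,V,T)\to H^n(\mathfrak g,D,V,T)$, $[z]\mapsto[\widetilde{\mathrm{VE}}_n z]$. -/

import Mathlib

open scoped Manifold ContDiff
open Set Filter Topology

namespace DiffLie
noncomputable section

section Power
variable {E H G E' H' M : Type*} [NormedAddCommGroup E] [NormedSpace ℝ E] [TopologicalSpace H]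
  [TopologicalSpace G] [ChartedSpace H G] [NormedAddCommGroup E'] [NormedSpace ℝ E']
  [TopologicalSpace H'] [TopologicalSpace M] [ChartedSpace H' M]

/-- The model of the product manifold `Gⁿ`. -/
abbrev powModel (I : ModelWithCorners ℝ E H) (n : ℕ) :
    ModelWithCorners ℝ (Fin n → E) (ModelPi fun _ : Fin n => H) :=
  ModelWithCorners.pi fun _ : Fin n => I

lemma contMDiff_power (I : ModelWithCorners ℝ E H) (J : ModelWithCorners ℝ E' H') {n : ℕ}
    {f : M → Fin n → G} (hf : ∀ i, ContMDiff J I ∞ fun x => f x i) :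
    ContMDiff J (powModel I n) ∞ f := by
  intro x
  rw [contMDiffAt_iff]
  refine ⟨continuousAt_pi.2 fun i => (hf i x).continuousAt, ?_⟩
  rw [contDiffWithinAt_pi]
  intro i
  exact (contMDiffAt_iff.1 (hf i x)).2

lemma contMDiff_power_apply (I : ModelWithCorners ℝ E H) {n : ℕ} (i : Fin n) :
    ContMDiff (powModel I n) I ∞ fun g : Fin n → G => g i := by
  intro x
  rw [contMDiffAt_iff]
  refine ⟨(continuous_apply i).continuousAt, ?_⟩
  have h : ContDiffWithinAt ℝ ∞ (fun y : Fin n → E => y i) (range (powModel I n))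
      (extChartAt (powModel I n) x x) := (contDiff_apply ℝ E i).contDiffWithinAt
  refine h.congr_of_eventuallyEq_of_mem ?_ ?_
  · have hs : (extChartAt (powModel I n) x).target ∈
        𝓝[range (powModel I n)] (extChartAt (powModel I n) x x) := extChartAt_target_mem_nhdsWithin x
    filter_upwards [hs] with y hy
    have hyi : y i ∈ (extChartAt I (x i)).target := ⟨hy.1 i trivial, hy.2 i trivial⟩
    exact (extChartAt I (x i)).right_inv hyi
  · exact mem_range_self _

lemma contMDiff_constSmul {V : Type*} [NormedAddCommGroup V] [NormedSpace ℝ V]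
    {J : ModelWithCorners ℝ E' H'} (c : ℝ) {f : M → V} (hf : ContMDiff J 𝓘(ℝ, V) ∞ f) :
    ContMDiff J 𝓘(ℝ, V) ∞ fun x => c • f x :=
  (contDiff_const_smul (𝕜 := ℝ) (F := V) (n := ∞) c).contMDiff.comp hf

end Power

section Exp
variable {d : ℕ} {G : Type*} [TopologicalSpace G] [ChartedSpace (EuclideanSpace ℝ (Fin d)) G]
  [Group G] [LieGroup (𝓡 d) ∞ G]

instance instLieGroupMinSmoothness : LieGroup (𝓡 d) (minSmoothness ℝ 3) G := by
  rw [minSmoothness_of_isRCLikeNormedField]; infer_instance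

lemma mdiff_mul_left (g : G) : MDifferentiable (𝓡 d) (𝓡 d) (g * ·) :=
  (contMDiff_mul_left (I := 𝓡 d) (n := ∞)).mdifferentiable (by simp)

lemma mfderiv_mulInvariant (x : GroupLieAlgebra (𝓡 d) G) (g h : G) :
    mfderiv (𝓡 d) (𝓡 d) (g * ·) h (mulInvariantVectorField x h) = mulInvariantVectorField x (g * h) := by
  have e : (fun b : G => g * h * b) = (g * ·) ∘ (h * ·) := by ext; simp [mul_assoc]
  simp only [mulInvariantVectorField]
  rw [e, mfderiv_comp (I' := 𝓡 d) (1 : G) (mdiff_mul_left g _) (mdiff_mul_left h _)]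
  have key : ∀ (k : G) (v : EuclideanSpace ℝ (Fin d)), k = h →
      (mfderiv (𝓡 d) (𝓡 d) (g * ·) h v : EuclideanSpace ℝ (Fin d)) =
        mfderiv (𝓡 d) (𝓡 d) (g * ·) k v := by
    rintro k v rfl; rfl
  exact key (h * 1) _ (mul_one h)

theorem exists_expCurve [T2Space G] (x : GroupLieAlgebra (𝓡 d) G) :
    ∃ γ : ℝ → G, γ 0 = 1 ∧ IsMIntegralCurve γ (mulInvariantVectorField (I := 𝓡 d) x) := by
  have hv : ContMDiff (𝓡 d) (𝓡 d).tangent 1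
      (fun g : G => (⟨g, mulInvariantVectorField x g⟩ : TangentBundle (𝓡 d) G)) :=
    (contMDiff_mulInvariantVectorField x).of_le
      (by rw [minSmoothness_of_isRCLikeNormedField]; exact one_le_two)
  obtain ⟨γ, h0, hγ⟩ := exists_isMIntegralCurveAt_of_contMDiffAt_boundaryless (t₀ := 0) (hv 1)
  rw [isMIntegralCurveAt_iff'] at hγ
  obtain ⟨ε, hε, hγ⟩ := hγ
  refine exists_isMIntegralCurve_of_isMIntegralCurveOn hv hε (fun g => ⟨fun t => g * γ t, by simp [h0], ?_⟩) 1
  intro t ht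
  have h1 := hγ t (by simpa [Real.ball_eq_Ioo] using ht)
  have h2 := ((mdiff_mul_left (d := d) g (γ t)).hasMFDerivAt).comp_hasMFDerivWithinAt t h1
  simp only [Real.ball_eq_Ioo, zero_sub, zero_add] at h2
  have e : (ContinuousLinearMap.smulRight (1 : ℝ →L[ℝ] ℝ)
      (mulInvariantVectorField x (g * γ t)) : ℝ →L[ℝ] EuclideanSpace ℝ (Fin d)) =
      (mfderiv (𝓡 d) (𝓡 d) (g * ·) (γ t)) ∘L
        ContinuousLinearMap.smulRight (1 : ℝ →L[ℝ] ℝ) (mulInvariantVectorField x (γ t)) := by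
    have key : ∀ (A : EuclideanSpace ℝ (Fin d) →L[ℝ] EuclideanSpace ℝ (Fin d))
        (v : EuclideanSpace ℝ (Fin d)), ContinuousLinearMap.smulRight (1 : ℝ →L[ℝ] ℝ) (A v) =
          A ∘L ContinuousLinearMap.smulRight (1 : ℝ →L[ℝ] ℝ) v := by
      intro A v; ext1; simp
    rw [← mfderiv_mulInvariant]
    exact key _ _
  change HasMFDerivWithinAt _ _ _ _ _ (ContinuousLinearMap.smulRight (1 : ℝ →L[ℝ] ℝ)
      (mulInvariantVectorField x (g * γ t)) : ℝ →L[ℝ] EuclideanSpace ℝ (Fin d))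
  rw [e]
  exact h2

/-- The Lie group exponential: the value at time `1` of the integral curve through the identity
of the left-invariant vector field generated by `x`. -/
def lieExp [T2Space G] (x : GroupLieAlgebra (𝓡 d) G) : G := (exists_expCurve x).choose 1
end Exp

section Groups
variable (d : ℕ) (G : Type*) [TopologicalSpace G] [ChartedSpace (EuclideanSpace ℝ (Fin d)) G]
  [Group G] (V : Type*) [NormedAddCommGroup V] [NormedSpace ℝ V]

/-- A difference operator on the Lie group `G`. -/
structure DifferenceOperator where
  toFun : G → G
  smooth : ContMDiff (𝓡 d) (𝓡 d) ∞ toFun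
  map_mul : ∀ g h, toFun (g * h) = toFun g * g * toFun h * g⁻¹

instance : CoeFun (DifferenceOperator d G) fun _ => G → G := ⟨DifferenceOperator.toFun⟩

/-- A Lie group homomorphism `G → GL(V)`; since `GL(V)` is open in `End(V)`, smoothness is tested
in the normed space `End(V)`. -/
structure SmoothRep where
  hom : G →* (V →L[ℝ] V)ˣ
  smooth : ContMDiff (𝓡 d) 𝓘(ℝ, V →L[ℝ] V) ∞ fun g => (hom g : V →L[ℝ] V)

instance : CoeFun (SmoothRep d G V) fun _ => G → V →L[ℝ] V := ⟨fun Θ g => (Θ.hom g : V →L[ℝ] V)⟩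

variable {d G}

/-- A representation `(V, T, Θ)` of the difference Lie group `(G, D)`. -/
structure DifferenceRep (D : DifferenceOperator d G) where
  T : V →ₗ[ℝ] V
  Θ : SmoothRep d G V
  compat : ∀ g u, T (Θ g u) + Θ g u = Θ (D g * g) (T u) + Θ (D g * g) u

lemma DifferenceOperator.map_one (D : DifferenceOperator d G) : D 1 = 1 := by
  have h := D.map_mul 1 1
  simpa using h

variable {V}

/-- The representation `Θ_D(g) = Θ(D(g) g)`. -/
def SmoothRep.twist [LieGroup (𝓡 d) ∞ G] (Θ : SmoothRep d G V) (D : DifferenceOperator d G) :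
    SmoothRep d G V where
  hom :=
    { toFun := fun g => Θ.hom (D g * g)
      map_one' := by simp [D.map_one]
      map_mul' := fun g h => by rw [D.map_mul, ← _root_.map_mul]; congr 1; group }
  smooth := Θ.smooth.comp (D.smooth.mul contMDiff_id)

variable (d G V)

/-- Normalized smooth `n`-cochains on the Lie group `G` with values in `V`. -/
def GroupCochain (n : ℕ) : Submodule ℝ ((Fin n → G) → V) where
  carrier := {α | ContMDiff (powModel (𝓡 d) n) 𝓘(ℝ, V) ∞ α ∧ ∀ g, (∃ i, g i = 1) → α g = 0}
  add_mem' ha hb := ⟨ha.1.add hb.1, fun g hg => by simp [ha.2 g hg, hb.2 g hg]⟩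
  zero_mem' := ⟨contMDiff_const, fun _ _ => rfl⟩
  smul_mem' c _ ha := ⟨contMDiff_constSmul c ha.1, fun g hg => by simp [ha.2 g hg]⟩

variable {d G V}

/-- The group coboundary. With indices counted from `0`, `Fin.contractNth i (· * ·) g` is
`(g₀, …, gᵢ gᵢ₊₁, …, gₙ)`. -/
def groupCobFun (Θ : SmoothRep d G V) {n : ℕ} (α : (Fin n → G) → V) (g : Fin (n + 1) → G) : V :=
  Θ (g 0) (α fun i => g i.succ)
    + ∑ i : Fin n, (-1 : ℝ) ^ (i.val + 1) • α (Fin.contractNth i.castSucc (· * ·) g)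
    + (-1 : ℝ) ^ (n + 1) • α fun i => g i.castSucc

lemma groupCobFun_eq (Θ : SmoothRep d G V) {n : ℕ} (α : (Fin n → G) → V) (g : Fin (n + 1) → G) :
    groupCobFun Θ α g = Θ (g 0) (α fun i => g i.succ)
      + ∑ i : Fin (n + 1), (-1 : ℝ) ^ (i.val + 1) • α (Fin.contractNth i (· * ·) g) := by
  have h : Fin.contractNth (Fin.last n) (· * ·) g = fun i => g i.castSucc := by
    ext k
    exact Fin.contractNth_apply_of_lt _ _ _ _ k.2
  rw [Fin.sum_univ_castSucc, h, groupCobFun, ← add_assoc]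
  rfl

lemma contMDiff_contractNth [LieGroup (𝓡 d) ∞ G] {n : ℕ} (j : Fin (n + 1)) :
    ContMDiff (powModel (𝓡 d) (n + 1)) (powModel (𝓡 d) n) ∞
      fun g : Fin (n + 1) → G => Fin.contractNth j (· * ·) g := by
  refine contMDiff_power _ _ fun k => ?_
  unfold Fin.contractNth
  split_ifs
  · exact contMDiff_power_apply _ _
  · exact (contMDiff_power_apply _ _).mul (contMDiff_power_apply _ _)
  · exact contMDiff_power_apply _ _

lemma groupCobFun_normalized (Θ : SmoothRep d G V) {n : ℕ} {α : (Fin n → G) → V}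
    (hα : ∀ g, (∃ i, g i = 1) → α g = 0) (g : Fin (n + 1) → G) (i : Fin (n + 1)) (hi : g i = 1) :
    groupCobFun Θ α g = 0 := by
  have e1 : ∀ j : Fin (n + 1), j.val ≠ i.val → j.val + 1 ≠ i.val →
      α (Fin.contractNth j (· * ·) g) = 0 := by
    intro j h1 h2
    refine hα _ ?_
    rcases lt_or_gt_of_ne h1 with h | h
    · refine ⟨⟨i.val - 1, by omega⟩, ?_⟩
      rw [Fin.contractNth_apply_of_gt _ _ _ _ (by simp only; omega), ← hi]
      congr 1; ext; simp only [Fin.succ_mk]; omega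
    · refine ⟨⟨i.val, by omega⟩, ?_⟩
      rw [Fin.contractNth_apply_of_lt _ _ _ _ (by simpa using h), ← hi]
      rfl
  have e2 : Fin.contractNth i (· * ·) g = fun k => g (i.succAbove k) := by
    ext k
    by_cases h : (i : ℕ) = k
    · rw [Fin.contractNth_apply_of_eq _ _ _ _ h.symm]
      have : k.castSucc = i := by ext; simp [h]
      rw [this, hi, one_mul, Fin.succAbove_of_le_castSucc _ _ this.symm.le]
    · exact Fin.contractNth_apply_of_ne _ _ _ _ h
  rw [groupCobFun_eq]
  rcases Fin.eq_zero_or_eq_succ i with rfl | ⟨j, rfl⟩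
  · rw [Finset.sum_eq_single 0 (fun j _ hj => by
      rw [e1 j (fun h => hj (Fin.ext h)) (Nat.succ_ne_zero _), smul_zero]) (by simp), e2, hi]
    simp
  · have e3 : Fin.contractNth j.castSucc (· * ·) g = fun k => g (j.succ.succAbove k) := by
      ext k
      rcases lt_trichotomy (k : ℕ) j with h | h | h
      · rw [Fin.contractNth_apply_of_lt _ _ _ _ h, Fin.succAbove_of_castSucc_lt]
        simp [Fin.lt_def]; omega
      · have hk : k = j := Fin.ext h
        rw [Fin.contractNth_apply_of_eq _ _ _ _ h, hk, hi, mul_one, Fin.succAbove_of_castSucc_lt]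
        simp [Fin.lt_def]
      · rw [Fin.contractNth_apply_of_gt _ _ _ _ h, Fin.succAbove_of_le_castSucc]
        simp [Fin.le_def]; omega
    have e0 : α (fun k => g k.succ) = 0 := hα _ ⟨j, hi⟩
    rw [e0, map_zero, zero_add, ← Finset.sum_subset (Finset.subset_univ {j.castSucc, j.succ})]
    · rw [Finset.sum_pair (by simp [Fin.ext_iff]), e2, e3]
      simp [pow_succ]
    · intro l _ hl
      simp only [Finset.mem_insert, Finset.mem_singleton, not_or, Fin.ext_iff, Fin.val_castSucc,
        Fin.val_succ] at hl
      rw [e1 l (by simpa using hl.2) (by simp; omega), smul_zero]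

/-- The coboundary operator of normalized smooth cochains with coefficients in `Θ`. -/
def groupCob [LieGroup (𝓡 d) ∞ G] (Θ : SmoothRep d G V) (n : ℕ) :
    GroupCochain d G V n →ₗ[ℝ] GroupCochain d G V (n + 1) where
  toFun α := ⟨groupCobFun Θ α.1, by
    refine ⟨?_, fun g ⟨i, hi⟩ => groupCobFun_normalized Θ α.2.2 g i hi⟩
    refine ContMDiff.add (ContMDiff.add ?_ ?_) ?_
    · exact (Θ.smooth.comp (contMDiff_power_apply _ 0)).clm_apply (α.2.1.comp
        (contMDiff_power _ _ fun i => contMDiff_power_apply _ _))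
    · exact contMDiff_finsetSum fun i _ =>
        contMDiff_constSmul _ (α.2.1.comp (contMDiff_contractNth _))
    · exact contMDiff_constSmul _
        (α.2.1.comp (contMDiff_power _ _ fun i => contMDiff_power_apply _ _))⟩
  map_add' α β := by
    ext g
    simp only [groupCobFun, Submodule.coe_add, Pi.add_apply, map_add, smul_add,
      Finset.sum_add_distrib]
    abel
  map_smul' c α := by
    ext g
    simp only [groupCobFun, SetLike.val_smul, Pi.smul_apply, map_smul, smul_add,
      RingHom.id_apply, Finset.smul_sum, smul_comm c]

/-- The first part of `𝔎`; in degree `0`, which the complex does not use, it is set to `0`. -/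
def pKFun {D : DifferenceOperator d G} (ρ : DifferenceRep V D) :
    (n : ℕ) → ((Fin n → G) → V) → (Fin n → G) → V
  | 1, α, g => -(ρ.Θ (D (g 0)) (α ![g 0])) + α ![D (g 0) * g 0] - α ![D (g 0)]
  | 2, α, g => α ![D (g 0), g 0] - α ![D (g 0 * g 1), g 0 * g 1]
      + ρ.Θ (D (g 0) * g 0) (α ![D (g 1), g 1])
  | _, _, _ => 0

/-- The second part of `𝔎`. -/
def hKFun {D : DifferenceOperator d G} (ρ : DifferenceRep V D) (n : ℕ)
    (α : (Fin n → G) → V) (g : Fin n → G) : V :=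
  (-1 : ℝ) ^ n • (α (fun i => D (g i) * g i) - ρ.T (α g) - α g)

lemma pKFun_add {D : DifferenceOperator d G} (ρ : DifferenceRep V D) (n : ℕ)
    (α β : (Fin n → G) → V) : pKFun ρ n (α + β) = pKFun ρ n α + pKFun ρ n β := by
  ext g
  match n with
  | 0 => simp [pKFun]
  | 1 => simp [pKFun]; abel
  | 2 => simp [pKFun]; abel
  | n + 3 => simp [pKFun]

lemma pKFun_smul {D : DifferenceOperator d G} (ρ : DifferenceRep V D) (n : ℕ) (c : ℝ)
    (α : (Fin n → G) → V) : pKFun ρ n (c • α) = c • pKFun ρ n α := by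
  ext g
  match n with
  | 0 => simp [pKFun]
  | 1 => simp [pKFun, smul_add, smul_sub]
  | 2 => simp [pKFun, smul_add, smul_sub]
  | n + 3 => simp [pKFun]

lemma pKFun_mem [LieGroup (𝓡 d) ∞ G] {D : DifferenceOperator d G} (ρ : DifferenceRep V D) (n : ℕ)
    {α : (Fin n → G) → V} (hα : α ∈ GroupCochain d G V n) : pKFun ρ n α ∈ GroupCochain d G V n := by
  have h1 := D.map_one
  match n with
  | 0 => exact zero_mem _
  | 1 =>
    have p0 := contMDiff_power_apply (G := G) (𝓡 d) (0 : Fin 1)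
    have q0 := D.smooth.comp p0
    refine ⟨ContMDiff.sub (ContMDiff.add (ContMDiff.neg ?_) ?_) ?_, ?_⟩
    · refine (ρ.Θ.smooth.comp q0).clm_apply (hα.1.comp (contMDiff_power _ _ fun i => ?_))
      fin_cases i; exact p0
    · refine hα.1.comp (contMDiff_power _ _ fun i => ?_)
      fin_cases i; exact q0.mul p0
    · refine hα.1.comp (contMDiff_power _ _ fun i => ?_)
      fin_cases i; exact q0
    · rintro g ⟨i, hi⟩
      have hg : g 0 = 1 := by rwa [Subsingleton.elim i 0] at hi
      have : α ![1] = 0 := hα.2 _ ⟨0, rfl⟩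
      simp [pKFun, hg, h1, this]
  | 2 =>
    have p0 := contMDiff_power_apply (G := G) (𝓡 d) (0 : Fin 2)
    have p1 := contMDiff_power_apply (G := G) (𝓡 d) (1 : Fin 2)
    have q0 := D.smooth.comp p0
    have q1 := D.smooth.comp p1
    refine ⟨ContMDiff.add (ContMDiff.sub ?_ ?_) ?_, ?_⟩
    · refine hα.1.comp (contMDiff_power _ _ fun i => ?_)
      fin_cases i
      exacts [q0, p0]
    · refine hα.1.comp (contMDiff_power _ _ fun i => ?_)
      fin_cases i
      exacts [D.smooth.comp (p0.mul p1), p0.mul p1]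
    · refine (ρ.Θ.smooth.comp (q0.mul p0)).clm_apply
        (hα.1.comp (contMDiff_power _ _ fun i => ?_))
      fin_cases i
      exacts [q1, p1]
    · rintro g ⟨i, hi⟩
      have : α ![1, 1] = 0 := hα.2 _ ⟨0, rfl⟩
      fin_cases i
      · have hg : g 0 = 1 := hi
        simp [pKFun, hg, h1, this]
      · have hg : g 1 = 1 := hi
        simp [pKFun, hg, h1, this]
  | n + 3 => exact zero_mem _

lemma hKFun_mem [LieGroup (𝓡 d) ∞ G] [FiniteDimensional ℝ V] {D : DifferenceOperator d G}
    (ρ : DifferenceRep V D) (n : ℕ)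
    {α : (Fin n → G) → V} (hα : α ∈ GroupCochain d G V n) : hKFun ρ n α ∈ GroupCochain d G V n := by
  refine ⟨contMDiff_constSmul _ (ContMDiff.sub (ContMDiff.sub ?_ ?_) hα.1), ?_⟩
  · exact hα.1.comp (contMDiff_power _ _ fun i =>
      (D.smooth.comp (contMDiff_power_apply _ i)).mul (contMDiff_power_apply _ i))
  · exact (LinearMap.toContinuousLinearMap ρ.T).contMDiff.comp hα.1
  · rintro g ⟨i, hi⟩
    have h2 : α (fun i => D (g i) * g i) = 0 := hα.2 _ ⟨i, by simp [hi, D.map_one]⟩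
    simp [hKFun, hα.2 g ⟨i, hi⟩, h2]

/-- The operator `𝔎` from `n`-cochains on `G` to `(n + 1)`-cochains of the difference operator,
which are `n`-cochains on `G`. -/
def groupK [LieGroup (𝓡 d) ∞ G] [FiniteDimensional ℝ V] {D : DifferenceOperator d G}
    (ρ : DifferenceRep V D) (n : ℕ) : GroupCochain d G V n →ₗ[ℝ] GroupCochain d G V n where
  toFun α := ⟨pKFun ρ n α.1 + hKFun ρ n α.1, add_mem (pKFun_mem ρ n α.2) (hKFun_mem ρ n α.2)⟩
  map_add' α β := by
    ext g
    simp only [Submodule.coe_add, pKFun_add, Pi.add_apply, hKFun, map_add, smul_sub, smul_add]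
    abel
  map_smul' c α := by
    ext g
    simp only [SetLike.val_smul, pKFun_smul, Pi.add_apply, Pi.smul_apply, hKFun, map_smul,
      RingHom.id_apply, smul_add, smul_sub, smul_comm c]
end Groups

section LieAlgebras
variable {L V : Type*} [LieRing L] [LieAlgebra ℝ L] [AddCommGroup V] [Module ℝ V]

/-- The Chevalley–Eilenberg coboundary of `ζ ∈ Hom(⋀ⁿ L, V)`, `n = m + 1`, with coefficients in
`θ`. The second sum runs over the pairs `i.castSucc < j.succ` of indices in `Fin (m + 2)`, that is,
over `i ≤ j` in `Fin (m + 1)`; the last argument is `x` with these two entries removed. -/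
def ceCobFun (θ : L →ₗ[ℝ] V →ₗ[ℝ] V) {m : ℕ} (ζ : L [⋀^Fin (m + 1)]→ₗ[ℝ] V)
    (x : Fin (m + 2) → L) : V :=
  ∑ i : Fin (m + 2), (-1 : ℤ) ^ i.val • θ (x i) (ζ (i.removeNth x))
    + ∑ i : Fin (m + 1), ∑ j ≥ i, (-1 : ℤ) ^ (i.castSucc.val + j.succ.val) •
        ζ (Fin.cons ⁅x i.castSucc, x j.succ⁆ (j.removeNth (i.castSucc.removeNth x)))

/-- The bilinear map `(x, y) ↦ ζ([x, y], ⋯)`. -/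
def bracketInsert {m : ℕ} (ζ : L [⋀^Fin (m + 1)]→ₗ[ℝ] V) :
    L →ₗ[ℝ] L →ₗ[ℝ] L [⋀^Fin m]→ₗ[ℝ] V :=
  LinearMap.mk₂ ℝ (fun x y => ζ.curryLeft ⁅x, y⁆) (by simp) (by simp) (by simp) (by simp)

/-- The linear map `x ↦ θ(x) ∘ ζ`. -/
def actInsert (θ : L →ₗ[ℝ] V →ₗ[ℝ] V) {n : ℕ} (ζ : L [⋀^Fin n]→ₗ[ℝ] V) :
    L →ₗ[ℝ] L [⋀^Fin n]→ₗ[ℝ] V where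
  toFun x := (θ x).compAlternatingMap ζ
  map_add' x y := by ext; simp
  map_smul' c x := by ext; simp

lemma ceCobFun_eq (θ : L →ₗ[ℝ] V →ₗ[ℝ] V) {m : ℕ} (ζ : L [⋀^Fin (m + 1)]→ₗ[ℝ] V) :
    ceCobFun θ ζ = ⇑(AlternatingMap.alternatizeUncurryFin (actInsert θ ζ)
      - (1 / 2 : ℝ) • AlternatingMap.alternatizeUncurryFin
        (AlternatingMap.alternatizeUncurryFinLM ∘ₗ bracketInsert ζ)) := by
  ext x
  rw [AlternatingMap.sub_apply, AlternatingMap.smul_apply,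
    AlternatingMap.alternatizeUncurryFin_alternatizeUncurryFinLM_comp_apply,
    AlternatingMap.alternatizeUncurryFin_apply, sub_eq_add_neg, ceCobFun]
  congr 1
  rw [Finset.smul_sum, ← Finset.sum_neg_distrib]
  refine Finset.sum_congr rfl fun i _ => ?_
  rw [Finset.smul_sum, ← Finset.sum_neg_distrib]
  refine Finset.sum_congr rfl fun j _ => ?_
  have h : ∀ (a b : L) (y : Fin m → L), bracketInsert ζ a b y = ζ (Fin.cons ⁅a, b⁆ y) :=
    fun a b y => rfl
  have h' : ∀ (a b : L) (y : Fin m → L), bracketInsert ζ b a y = - bracketInsert ζ a b y := by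
    intro a b y
    have : bracketInsert ζ b a = - bracketInsert ζ a b := by
      change ζ.curryLeft ⁅b, a⁆ = - ζ.curryLeft ⁅a, b⁆
      rw [← lie_skew, map_neg]
    rw [this]; rfl
  rw [h' (x i.castSucc) (x j.succ), sub_neg_eq_add, ← two_smul ℝ, smul_comm (_ : ℤ) (2 : ℝ),
    smul_smul, h]
  norm_num [pow_add, pow_succ]

/-- The Chevalley–Eilenberg coboundary operator on `Hom(⋀ⁿ L, V)`, `n = m + 1`. -/
def ceCob (θ : L →ₗ[ℝ] V →ₗ[ℝ] V) (m : ℕ) :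
    L [⋀^Fin (m + 1)]→ₗ[ℝ] V →ₗ[ℝ] L [⋀^Fin (m + 2)]→ₗ[ℝ] V where
  toFun ζ :=
    { toFun := ceCobFun θ ζ
      map_update_add' := by
        intro inst x i a b
        rw [ceCobFun_eq]
        exact AlternatingMap.map_update_add _ _ _ _ _
      map_update_smul' := by
        intro inst x i c a
        rw [ceCobFun_eq]
        exact AlternatingMap.map_update_smul _ _ _ _ _
      map_eq_zero_of_eq' := by
        intro x i j h hij
        change ceCobFun θ ζ x = 0
        rw [ceCobFun_eq]
        exact AlternatingMap.map_eq_zero_of_eq _ _ h hij }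
  map_add' ζ ξ := by
    ext x
    change ceCobFun θ (ζ + ξ) x = ceCobFun θ ζ x + ceCobFun θ ξ x
    simp only [ceCobFun, AlternatingMap.add_apply, map_add, smul_add, Finset.sum_add_distrib]
    abel
  map_smul' c ζ := by
    ext x
    change ceCobFun θ (c • ζ) x = c • ceCobFun θ ζ x
    simp only [ceCobFun, AlternatingMap.smul_apply, map_smul, smul_add, Finset.smul_sum,
      smul_comm c]

/-- `K(ζ)(x₁, …, xₙ)`: the sum runs over the non-empty sets `{i₁ < ⋯ < i_k}` of positions at
which `D` is applied. -/
def lieKFun (D : L →ₗ[ℝ] L) (T : V →ₗ[ℝ] V) {n : ℕ} (ζ : L [⋀^Fin n]→ₗ[ℝ] V) (x : Fin n → L) : V :=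
  (-1 : ℝ) ^ n • (∑ s : Finset (Fin n) with s.Nonempty, ζ (s.piecewise (fun i => D (x i)) x)
    - T (ζ x))

lemma lieKFun_eq (D : L →ₗ[ℝ] L) (T : V →ₗ[ℝ] V) {n : ℕ} (ζ : L [⋀^Fin n]→ₗ[ℝ] V) :
    lieKFun D T ζ = ⇑((-1 : ℝ) ^ n •
      (ζ.compLinearMap (D + LinearMap.id) - ζ - T.compAlternatingMap ζ) : L [⋀^Fin n]→ₗ[ℝ] V) := by
  ext x
  have h : ζ (fun i => D (x i) + x i) =
      ∑ s : Finset (Fin n), ζ (s.piecewise (fun i => D (x i)) x) :=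
    ζ.toMultilinearMap.map_add_univ (fun i => D (x i)) x
  have h2 : ∑ s : Finset (Fin n) with s.Nonempty, ζ (s.piecewise (fun i => D (x i)) x) =
      ∑ s : Finset (Fin n), ζ (s.piecewise (fun i => D (x i)) x) - ζ x := by
    rw [← Finset.sum_filter_add_sum_filter_not Finset.univ Finset.Nonempty]
    simp [Finset.not_nonempty_iff_eq_empty, Finset.filter_eq']
  rw [lieKFun, h2, ← h]
  rfl

/-- The operator `K` on `Hom(⋀ⁿ L, V)`. -/
def lieK (D : L →ₗ[ℝ] L) (T : V →ₗ[ℝ] V) (n : ℕ) :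
    L [⋀^Fin n]→ₗ[ℝ] V →ₗ[ℝ] L [⋀^Fin n]→ₗ[ℝ] V where
  toFun ζ :=
    { toFun := lieKFun D T ζ
      map_update_add' := by
        intro inst x i a b
        rw [lieKFun_eq]
        exact AlternatingMap.map_update_add _ _ _ _ _
      map_update_smul' := by
        intro inst x i c a
        rw [lieKFun_eq]
        exact AlternatingMap.map_update_smul _ _ _ _ _
      map_eq_zero_of_eq' := by
        intro x i j h hij
        change lieKFun D T ζ x = 0
        rw [lieKFun_eq]
        exact AlternatingMap.map_eq_zero_of_eq _ _ h hij }
  map_add' ζ ξ := by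
    ext x
    change lieKFun D T (ζ + ξ) x = lieKFun D T ζ x + lieKFun D T ξ x
    simp only [lieKFun, AlternatingMap.add_apply, map_add, smul_add, smul_sub,
      Finset.sum_add_distrib]
    abel
  map_smul' c ζ := by
    ext x
    change lieKFun D T (c • ζ) x = c • lieKFun D T ζ x
    simp only [lieKFun, AlternatingMap.smul_apply, map_smul, smul_sub, Finset.smul_sum,
      smul_comm c]

/-- The representation `θ_D(x) = θ(x) + θ(D(x))`. -/
def lieTwist (θ : L →ₗ[ℝ] V →ₗ[ℝ] V) (D : L →ₗ[ℝ] L) : L →ₗ[ℝ] V →ₗ[ℝ] V := θ + θ ∘ₗ D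

end LieAlgebras

/-! Both complexes start in degree `1`. They are indexed by `k = n - 1`. -/

section Complexes
universe u v

/-- For a family `C¹, C², …` of spaces, the space `0` for `k = 0`, and `Cᵏ` for `k ≥ 1`.
This is the space of cochains of degree `n = k + 1` of the difference operator. -/
def OpCochain (C : ℕ → Type u) : ℕ → Type u
  | 0 => PUnit
  | k + 1 => C (k + 1)

variable (C : ℕ → Type u) (C' : ℕ → Type v) [∀ n, AddCommGroup (C n)] [∀ n, Module ℝ (C n)]
  [∀ n, AddCommGroup (C' n)] [∀ n, Module ℝ (C' n)]

instance : ∀ k, AddCommGroup (OpCochain C k)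
  | 0 => inferInstanceAs (AddCommGroup PUnit.{u + 1})
  | k + 1 => inferInstanceAs (AddCommGroup (C (k + 1)))

instance : ∀ k, Module ℝ (OpCochain C k)
  | 0 => (inferInstance : Module ℝ PUnit.{u + 1})
  | k + 1 => inferInstanceAs (Module ℝ (C (k + 1)))

variable {C C'}

/-- The coboundary operator on the cochains of the difference operator, for
`d : Cⁿ → Cⁿ⁺¹`, `n ≥ 1`. -/
def opCob (d : ∀ k, C (k + 1) →ₗ[ℝ] C (k + 2)) : ∀ k, OpCochain C k →ₗ[ℝ] C (k + 1)
  | 0 => 0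
  | k + 1 => d k

/-- The map on cochains of the difference operator given by `f : Cⁿ → C'ⁿ`, `n ≥ 1`. -/
def opMap (f : ∀ n, C n →ₗ[ℝ] C' n) : ∀ k, OpCochain C k →ₗ[ℝ] OpCochain C' k
  | 0 => 0
  | k + 1 => f (k + 1)

/-- `(α, β) ↦ (d α, d' β + K α)`, from degree `n = k + 1` to degree `n + 1`. -/
def totalCob (d d' : ∀ k, C (k + 1) →ₗ[ℝ] C (k + 2)) (K : ∀ n, C n →ₗ[ℝ] C n) (k : ℕ) :
    C (k + 1) × OpCochain C k →ₗ[ℝ] C (k + 2) × OpCochain C (k + 1) :=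
  LinearMap.prod (d k ∘ₗ LinearMap.fst ℝ _ _)
    (opCob d' k ∘ₗ LinearMap.snd ℝ _ _ + K (k + 1) ∘ₗ LinearMap.fst ℝ _ _ :
      C (k + 1) × OpCochain C k →ₗ[ℝ] C (k + 1))

/-- `(α, β) ↦ (f α, f β)` in degree `n = k + 1`. -/
def totalMap (f : ∀ n, C n →ₗ[ℝ] C' n) (k : ℕ) :
    C (k + 1) × OpCochain C k →ₗ[ℝ] C' (k + 1) × OpCochain C' k :=
  (f (k + 1)).prodMap (opMap f k)

variable {X : ℕ → Type*} [∀ k, AddCommGroup (X k)] [∀ k, Module ℝ (X k)]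

/-- The coboundaries of a complex `X 0 → X 1 → ⋯`. -/
def coboundaries (δ : ∀ k, X k →ₗ[ℝ] X (k + 1)) : ∀ k, Submodule ℝ (X k)
  | 0 => ⊥
  | k + 1 => LinearMap.range (δ k)

/-- The cohomology (cocycles modulo coboundaries) of a complex `X 0 → X 1 → ⋯`. -/
abbrev Cohomology (δ : ∀ k, X k →ₗ[ℝ] X (k + 1)) (k : ℕ) : Type _ :=
  LinearMap.ker (δ k) ⧸ (coboundaries δ k).submoduleOf (LinearMap.ker (δ k))

/-- The class of a cocycle. -/
abbrev cohClass (δ : ∀ k, X k →ₗ[ℝ] X (k + 1)) (k : ℕ) (z : LinearMap.ker (δ k)) :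
    Cohomology δ k :=
  Submodule.Quotient.mk z

end Complexes

section VanEst
variable {d : ℕ} {G : Type*} [TopologicalSpace G] [ChartedSpace (EuclideanSpace ℝ (Fin d)) G]
  [Group G] [LieGroup (𝓡 d) ∞ G]
  {V : Type*} [NormedAddCommGroup V] [NormedSpace ℝ V] [FiniteDimensional ℝ V]

/-- The derivative at the identity of the difference operator; `D(1) = 1`, so the target is again
the tangent space at the identity. -/
def DifferenceOperator.lie (D : DifferenceOperator d G) :
    GroupLieAlgebra (𝓡 d) G →ₗ[ℝ] GroupLieAlgebra (𝓡 d) G :=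
  (mfderiv (𝓡 d) (𝓡 d) D 1 : EuclideanSpace ℝ (Fin d) →L[ℝ] EuclideanSpace ℝ (Fin d)).toLinearMap

/-- The derivative at the identity of a representation of `G`. -/
def SmoothRep.lie (Θ : SmoothRep d G V) : GroupLieAlgebra (𝓡 d) G →ₗ[ℝ] V →ₗ[ℝ] V :=
  ContinuousLinearMap.coeLM ℝ ∘ₗ
    (mfderiv (𝓡 d) 𝓘(ℝ, V →L[ℝ] V) (fun g => Θ g) 1 :
      EuclideanSpace ℝ (Fin d) →L[ℝ] V →L[ℝ] V).toLinearMap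

variable (d G V) in
/-- `Hom(⋀ⁿ 𝔤, V)` -/
abbrev LieCochain (n : ℕ) : Type _ := GroupLieAlgebra (𝓡 d) G [⋀^Fin n]→ₗ[ℝ] V

/-- The coboundary operator of the difference Lie group in degree `n = k + 1`. -/
def groupDelta {D : DifferenceOperator d G} (ρ : DifferenceRep V D) (k : ℕ) :
    GroupCochain d G V (k + 1) × OpCochain (fun n => GroupCochain d G V n) k →ₗ[ℝ]
      GroupCochain d G V (k + 2) × OpCochain (fun n => GroupCochain d G V n) (k + 1) :=
  totalCob (C := fun n => GroupCochain d G V n) (fun k => groupCob ρ.Θ (k + 1))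
    (fun k => groupCob (ρ.Θ.twist D) (k + 1)) (groupK ρ) k

/-- The coboundary operator of the difference Lie algebra `(𝔤, D_*)` with coefficients in
`(V, T, Θ_*)`, in degree `n = k + 1`. -/
def lieDelta {D : DifferenceOperator d G} (ρ : DifferenceRep V D) (k : ℕ) :
    LieCochain d G V (k + 1) × OpCochain (LieCochain d G V) k →ₗ[ℝ]
      LieCochain d G V (k + 2) × OpCochain (LieCochain d G V) (k + 1) :=
  totalCob (C := LieCochain d G V) (ceCob ρ.Θ.lie) (ceCob (lieTwist ρ.Θ.lie D.lie))
    (lieK D.lie ρ.T) k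

/-- `∂/∂t₁ ⋯ ∂/∂tₙ F` at `t₁ = ⋯ = tₙ = 0`. -/
def mixedDeriv : (n : ℕ) → ((Fin n → ℝ) → V) → V
  | 0, F => F ![]
  | n + 1, F => deriv (fun t => mixedDeriv n fun s => F (Fin.cons t s)) 0

/-- The formula for the van Est map; the variable `t i` is the one attached to `x (ε i)`. -/
def vanEstFun [T2Space G] {n : ℕ} (α : (Fin n → G) → V) (x : Fin n → GroupLieAlgebra (𝓡 d) G) : V :=
  ∑ ε : Equiv.Perm (Fin n), (Equiv.Perm.sign ε : ℤ) •
    mixedDeriv n fun t => α fun i => lieExp (t i • x (ε i))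

end VanEst
end
end DiffLie

open DiffLie

/-!
The van Est map antisymmetrizes the mixed derivative `Jα` of a cochain `α` at the identity along
one-parameter subgroups. In the chart at `e`, `Jα` is the `n`-th Fréchet derivative of `α` applied
to vectors on the coordinate axes: hence it is multilinear and does not change when the subgroups
`exp (t xᵢ)` are replaced by other curves through `e` with the same velocities.

In `d^Θ α` the first term has derivative `θ(u₁) Jα(u₂, …)` and the last is constant in one of the
variables. Interchanging `uₖ` and `uₖ₊₁` changes the derivative of `α(…, gₖ gₖ₊₁, …)` by
`Jα(…, [uₖ, uₖ₊₁], …)`, since the bracket is the commutator of left-invariant derivations.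
Antisymmetrizing these identities gives the Chevalley–Eilenberg formula.

As for `𝔎`, the curve `D(exp (t x)) exp (t x)` has velocity `D x + x`, which turns `h` into `K`. The
term `p(α)` is invisible: let `η_D(g) = η(D(g), g)` for a two-cochain `η`; then `p(α)` is
`-(d^Θ α)_D` in degree one and `d^{Θ_D}(α_D)` in degree two, and `J` annihilates every `η_D` because
a normalized two-cochain has vanishing first derivative at the identity.
-/

namespace DiffLie
noncomputable section

section Antisymmetrization
variable {X V : Type*} [AddCommGroup V] {n : ℕ}

/-- The antisymmetrization `x ↦ ∑ ε, sign ε • A (x ∘ ε)` of a function of `n` variables, which need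
not be multilinear; on multilinear maps it is `MultilinearMap.alternatization`. -/
def altSum (A : (Fin n → X) → V) (x : Fin n → X) : V :=
  ∑ ε : Equiv.Perm (Fin n), (Equiv.Perm.sign ε : ℤ) • A fun i => x (ε i)

lemma altSum_add (A B : (Fin n → X) → V) (x : Fin n → X) :
    altSum (fun u => A u + B u) x = altSum A x + altSum B x := by
  simp only [altSum, smul_add, Finset.sum_add_distrib]

lemma altSum_sub (A B : (Fin n → X) → V) (x : Fin n → X) :
    altSum (fun u => A u - B u) x = altSum A x - altSum B x := by
  simp only [altSum, smul_sub, Finset.sum_sub_distrib]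

lemma altSum_sum {ι : Type*} (s : Finset ι) (A : ι → (Fin n → X) → V) (x : Fin n → X) :
    altSum (fun u => ∑ k ∈ s, A k u) x = ∑ k ∈ s, altSum (A k) x := by
  simp only [altSum, Finset.smul_sum]
  exact Finset.sum_comm

lemma altSum_map {W F : Type*} [AddCommGroup W] [FunLike F V W] [AddMonoidHomClass F V W] (f : F)
    (A : (Fin n → X) → V) (x : Fin n → X) : altSum (fun u => f (A u)) x = f (altSum A x) := by
  simp only [altSum, map_sum, map_zsmul]

lemma altSum_smul [Module ℝ V] (a : ℝ) (A : (Fin n → X) → V) (x : Fin n → X) :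
    altSum (fun u => a • A u) x = a • altSum A x :=
  altSum_map (DistribSMul.toAddMonoidHom V a) A x

lemma altSum_zero (x : Fin n → X) : altSum (fun _ => (0 : V)) x = 0 := by
  simp only [altSum, smul_zero, Finset.sum_const_zero]

lemma altSum_comp_perm (A : (Fin n → X) → V) (σ : Equiv.Perm (Fin n)) (x : Fin n → X) :
    altSum (fun u => A fun i => u (σ i)) x = (Equiv.Perm.sign σ : ℤ) • altSum A x := by
  simp only [altSum, Finset.smul_sum]
  refine Fintype.sum_equiv (Equiv.mulRight σ) _ _ fun ε => ?_
  have h : (Equiv.Perm.sign σ : ℤ) * (Equiv.Perm.sign ε * Equiv.Perm.sign σ : ℤ) =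
      Equiv.Perm.sign ε := by
    rw [mul_left_comm, Int.units_coe_mul_self, mul_one]
  simp only [Equiv.coe_mulRight, Equiv.Perm.sign_mul, Units.val_mul, smul_smul, h]
  rfl

lemma altSum_sub_swap {i j : Fin n} (hij : i ≠ j) (A : (Fin n → X) → V) (x : Fin n → X) :
    altSum (fun u => A u - A fun l => u (Equiv.swap i j l)) x = 2 • altSum A x := by
  rw [altSum_sub, altSum_comp_perm, Equiv.Perm.sign_swap hij, two_smul]
  simp

/-- The permutation of `Fin (n + 1)` that fixes `0` and acts on the successors by `τ`. -/
def permSucc (τ : Equiv.Perm (Fin n)) : Equiv.Perm (Fin (n + 1)) :=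
  Equiv.Perm.decomposeFin.symm (0, τ)

@[simp] lemma permSucc_zero (τ : Equiv.Perm (Fin n)) : permSucc τ 0 = 0 := by
  simp [permSucc]

@[simp] lemma permSucc_succ (τ : Equiv.Perm (Fin n)) (i : Fin n) :
    permSucc τ i.succ = (τ i).succ := by
  simp [permSucc]

@[simp] lemma sign_permSucc (τ : Equiv.Perm (Fin n)) :
    Equiv.Perm.sign (permSucc τ) = Equiv.Perm.sign τ := by
  simp [permSucc]

lemma permSucc_injective : Function.Injective (permSucc (n := n)) := by
  intro σ τ h
  simpa [permSucc] using h

lemma cons_comp_permSucc (z : X) (y : Fin n → X) (τ : Equiv.Perm (Fin n)) :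
    (fun i => (Fin.cons z y : Fin (n + 1) → X) (permSucc τ i)) = Fin.cons z fun i => y (τ i) := by
  ext i
  cases i using Fin.cases <;> simp

lemma bijective_cycleRange_symm_mul_permSucc (n : ℕ) :
    Function.Bijective fun p : Fin (n + 1) × Equiv.Perm (Fin n) =>
      p.1.cycleRange.symm * permSucc p.2 := by
  rw [Fintype.bijective_iff_injective_and_card]
  refine ⟨?_, by simp [Fintype.card_perm, Nat.factorial_succ]⟩
  rintro ⟨i, σ⟩ ⟨j, τ⟩ h
  obtain rfl : i = j := by simpa using DFunLike.congr_fun h 0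
  simpa using permSucc_injective (mul_left_cancel h)

lemma bijective_permSucc_mul_cycleRange (n : ℕ) :
    Function.Bijective fun p : Fin (n + 1) × Equiv.Perm (Fin n) =>
      permSucc p.2 * p.1.cycleRange := by
  rw [Fintype.bijective_iff_injective_and_card]
  refine ⟨?_, by simp [Fintype.card_perm, Nat.factorial_succ]⟩
  rintro ⟨i, σ⟩ ⟨j, τ⟩ h
  have h0 : permSucc τ (j.cycleRange i) = permSucc τ 0 := by
    simpa using (DFunLike.congr_fun h i).symm
  obtain rfl : i = j := by
    rw [← Fin.cycleRange_symm_zero j, Equiv.eq_symm_apply]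
    exact (permSucc τ).injective h0
  simpa using permSucc_injective (mul_right_cancel h)

lemma altSum_eq_sum_removeNth (A : (Fin (n + 1) → X) → V) (x : Fin (n + 1) → X) :
    altSum A x = ∑ i : Fin (n + 1), (-1 : ℤ) ^ i.val •
      altSum (fun y => A (Fin.cons (x i) y)) (i.removeNth x) := by
  simp only [altSum, Finset.smul_sum]
  rw [← Fintype.sum_prod_type']
  refine (Fintype.sum_equiv (Equiv.ofBijective _ (bijective_cycleRange_symm_mul_permSucc n))
    _ _ fun p => ?_).symm
  rw [smul_smul]
  congr 1
  · simp
  · congr 1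
    ext i
    cases i using Fin.cases <;> simp [Fin.removeNth]

lemma altSum_cons (A : (Fin (n + 1) → X) → V) (z : X) (y : Fin n → X) :
    altSum A (Fin.cons z y) = ∑ k : Fin (n + 1), (-1 : ℤ) ^ k.val •
      altSum (fun w => A (k.insertNth z w)) y := by
  simp only [altSum, Finset.smul_sum]
  rw [← Fintype.sum_prod_type']
  refine (Fintype.sum_equiv (Equiv.ofBijective _ (bijective_permSucc_mul_cycleRange n))
    _ _ fun p => ?_).symm
  rw [smul_smul]
  congr 1
  · simp [mul_comm]
  · congr 1
    rw [← Fin.cons_comp_cycleRange, ← cons_comp_permSucc]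
    rfl

lemma altSum_castSucc_succ (B : X → X → (Fin n → X) → V) (k : Fin (n + 1)) (x : Fin (n + 2) → X) :
    altSum (fun u => B (u k.castSucc) (u k.succ) (k.removeNth (k.castSucc.removeNth u))) x =
      altSum (fun u => B (u 0) (u 1) fun i => u i.succ.succ) x := by
  set σ : Equiv.Perm (Fin (n + 2)) := k.castSucc.cycleRange.symm * permSucc k.cycleRange.symm
  have sign_eq : Equiv.Perm.sign σ = 1 := by simp [σ, ← mul_pow]
  have map_zero : σ 0 = k.castSucc := by simp [σ]
  have map_one : σ 1 = k.succ := by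
    rw [← Fin.succ_zero_eq_one, Equiv.Perm.mul_apply, permSucc_succ, Fin.cycleRange_symm_zero,
      Fin.cycleRange_symm_succ, Fin.succAbove_castSucc_self]
  have map_succ_succ : ∀ i : Fin n, σ i.succ.succ = k.castSucc.succAbove (k.succAbove i) := by
    simp [σ]
  have h := altSum_comp_perm (fun u => B (u 0) (u 1) fun i => u i.succ.succ) σ x
  rw [sign_eq, Units.val_one, one_smul] at h
  simp only [map_zero, map_one, map_succ_succ] at h
  exact h

end Antisymmetrization

section FinTuples
variable {X : Type*}

lemma contractNth_zero_cons_cons {m : ℕ} (op : X → X → X) (a b : X) (g : Fin m → X) :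
    Fin.contractNth (0 : Fin (m + 2)) op (Fin.cons a (Fin.cons b g)) = Fin.cons (op a b) g := by
  ext i
  cases i using Fin.cases with
  | zero => exact Fin.contractNth_apply_of_eq _ _ _ _ rfl
  | succ i => exact Fin.contractNth_apply_of_gt _ _ _ _ (Nat.succ_pos _)

lemma contractNth_succ_cons {m : ℕ} (op : X → X → X) (k : Fin (m + 1)) (a : X)
    (g : Fin (m + 1) → X) :
    Fin.contractNth k.succ op (Fin.cons a g : Fin (m + 2) → X) =
      Fin.cons a (Fin.contractNth k op g) := by
  ext i
  cases i using Fin.cases with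
  | zero => exact Fin.contractNth_apply_of_lt _ _ _ _ (Nat.succ_pos _)
  | succ i =>
    rw [Fin.cons_succ]
    rcases lt_trichotomy (i : ℕ) k with h | h | h
    · rw [Fin.contractNth_apply_of_lt _ _ _ _ h]
      exact Fin.contractNth_apply_of_lt _ _ _ _ (Nat.succ_lt_succ h)
    · rw [Fin.contractNth_apply_of_eq _ _ _ _ h]
      exact Fin.contractNth_apply_of_eq _ _ _ _ (congrArg Nat.succ h)
    · rw [Fin.contractNth_apply_of_gt _ _ _ _ h]
      exact Fin.contractNth_apply_of_gt _ _ _ _ (Nat.succ_lt_succ h)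

lemma insertNth_removeNth_removeNth_succ_cons {m : ℕ} (k : Fin (m + 1)) (a z : X)
    (u : Fin (m + 2) → X) :
    k.succ.insertNth z (k.succ.removeNth
        (k.castSucc.succ.removeNth (Fin.cons a u : Fin (m + 3) → X))) =
      (Fin.cons a (k.insertNth z (k.removeNth (k.castSucc.removeNth u)) : Fin (m + 1) → X) :
        Fin (m + 2) → X) := by
  rw [Fin.insertNth_eq_iff]
  refine ⟨by simp, ?_⟩
  ext i
  cases i using Fin.cases <;> simp [Fin.removeNth]

end FinTuples

section ChevalleyEilenberg
variable {L V : Type*} [LieRing L] [LieAlgebra ℝ L] [AddCommGroup V] [Module ℝ V] {m : ℕ}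
  {ζ : L [⋀^Fin (m + 1)]→ₗ[ℝ] V} {A : (Fin (m + 1) → L) → V}

lemma alternatizeUncurryFin_actInsert (θ : L →ₗ[ℝ] V →ₗ[ℝ] V) (hζ : ∀ y, ζ y = altSum A y)
    (x : Fin (m + 2) → L) :
    AlternatingMap.alternatizeUncurryFin (actInsert θ ζ) x =
      altSum (fun u => θ (u 0) (A fun i => u i.succ)) x := by
  rw [AlternatingMap.alternatizeUncurryFin_apply, altSum_eq_sum_removeNth]
  refine Finset.sum_congr rfl fun i _ => congrArg _ ?_
  change θ (x i) (ζ (i.removeNth x)) = altSum (fun y => θ (x i) (A y)) (i.removeNth x)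
  rw [hζ, altSum_map]

lemma alternatizeUncurryFin_bracketInsert (hζ : ∀ y, ζ y = altSum A y) (x : Fin (m + 2) → L) :
    AlternatingMap.alternatizeUncurryFin
        (AlternatingMap.alternatizeUncurryFinLM ∘ₗ bracketInsert ζ) x =
      ∑ k : Fin (m + 1), (-1 : ℤ) ^ k.val • altSum (fun u =>
        A (k.insertNth ⁅u k.castSucc, u k.succ⁆ (k.removeNth (k.castSucc.removeNth u)))) x := by
  have expand : ∀ k : Fin (m + 1), altSum (fun u =>
        A (k.insertNth ⁅u k.castSucc, u k.succ⁆ (k.removeNth (k.castSucc.removeNth u)))) x =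
      ∑ i : Fin (m + 2), ∑ j : Fin (m + 1), (-1 : ℤ) ^ i.val • (-1 : ℤ) ^ j.val •
        altSum (fun w => A (k.insertNth ⁅x i, i.removeNth x j⁆ w))
          (j.removeNth (i.removeNth x)) := by
    intro k
    rw [altSum_castSucc_succ (fun a b w => A (k.insertNth ⁅a, b⁆ w)), altSum_eq_sum_removeNth]
    refine Finset.sum_congr rfl fun i _ => ?_
    rw [altSum_eq_sum_removeNth, Finset.smul_sum]
    rfl
  simp only [expand, Finset.smul_sum]
  rw [Finset.sum_comm, AlternatingMap.alternatizeUncurryFin_apply]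
  refine Finset.sum_congr rfl fun i _ => ?_
  rw [LinearMap.comp_apply, AlternatingMap.alternatizeUncurryFinLM_apply,
    AlternatingMap.alternatizeUncurryFin_apply, Finset.smul_sum, Finset.sum_comm]
  refine Finset.sum_congr rfl fun j _ => ?_
  change _ • _ • ζ (Fin.cons ⁅x i, i.removeNth x j⁆ (j.removeNth (i.removeNth x))) = _
  rw [hζ, altSum_cons, Finset.smul_sum, Finset.smul_sum]
  refine Finset.sum_congr rfl fun k _ => ?_
  rw [smul_comm ((-1 : ℤ) ^ j.val), smul_comm ((-1 : ℤ) ^ i.val)]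

lemma ceCob_apply_of_eq_altSum (θ : L →ₗ[ℝ] V →ₗ[ℝ] V) (hζ : ∀ y, ζ y = altSum A y)
    (x : Fin (m + 2) → L) :
    ceCob θ m ζ x = altSum (fun u => θ (u 0) (A fun i => u i.succ)) x
      - (1 / 2 : ℝ) • ∑ k : Fin (m + 1), (-1 : ℤ) ^ k.val • altSum (fun u =>
          A (k.insertNth ⁅u k.castSucc, u k.succ⁆ (k.removeNth (k.castSucc.removeNth u)))) x := by
  rw [← alternatizeUncurryFin_actInsert θ hζ, ← alternatizeUncurryFin_bracketInsert hζ]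
  exact congrFun (ceCobFun_eq θ ζ) x

end ChevalleyEilenberg

section LieK
variable {L V : Type*} [LieRing L] [LieAlgebra ℝ L] [AddCommGroup V] [Module ℝ V]

lemma lieK_apply (D : L →ₗ[ℝ] L) (T : V →ₗ[ℝ] V) {n : ℕ} (ζ : L [⋀^Fin n]→ₗ[ℝ] V)
    (x : Fin n → L) : lieK D T n ζ x =
      (-1 : ℝ) ^ n • (ζ (fun i => D (x i) + x i) - ζ x - T (ζ x)) :=
  congrFun (lieKFun_eq D T ζ) x

end LieK

section Cohomology
universe u v
variable {C : ℕ → Type u} {C' : ℕ → Type v} [∀ n, AddCommGroup (C n)] [∀ n, Module ℝ (C n)]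
  [∀ n, AddCommGroup (C' n)] [∀ n, Module ℝ (C' n)]

lemma opMap_opCob (f : ∀ n, C n →ₗ[ℝ] C' n) {d : ∀ k, C (k + 1) →ₗ[ℝ] C (k + 2)}
    {d' : ∀ k, C' (k + 1) →ₗ[ℝ] C' (k + 2)} (hd : ∀ k, f (k + 2) ∘ₗ d k = d' k ∘ₗ f (k + 1)) :
    ∀ k b, f (k + 1) (opCob d k b) = opCob d' k (opMap f k b)
  | 0, _ => map_zero _
  | k + 1, b => LinearMap.congr_fun (hd k) b

lemma totalMap_comp_totalCob (f : ∀ n, C n →ₗ[ℝ] C' n) {d e : ∀ k, C (k + 1) →ₗ[ℝ] C (k + 2)}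
    {d' e' : ∀ k, C' (k + 1) →ₗ[ℝ] C' (k + 2)} {K : ∀ n, C n →ₗ[ℝ] C n}
    {K' : ∀ n, C' n →ₗ[ℝ] C' n} (hd : ∀ k, f (k + 2) ∘ₗ d k = d' k ∘ₗ f (k + 1))
    (he : ∀ k, f (k + 2) ∘ₗ e k = e' k ∘ₗ f (k + 1))
    (hK : ∀ k, f (k + 1) ∘ₗ K (k + 1) = K' (k + 1) ∘ₗ f (k + 1)) (k : ℕ) :
    totalMap f (k + 1) ∘ₗ totalCob d e K k = totalCob d' e' K' k ∘ₗ totalMap f k := by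
  refine LinearMap.ext fun z => Prod.ext (LinearMap.congr_fun (hd k) z.1) ?_
  change f (k + 1) (opCob e k z.2 + K (k + 1) z.1) =
    opCob e' k (opMap f k z.2) + K' (k + 1) (f (k + 1) z.1)
  rw [map_add, opMap_opCob f he]
  exact congrArg _ (LinearMap.congr_fun (hK k) z.1)

variable {X Y : ℕ → Type*} [∀ k, AddCommGroup (X k)] [∀ k, Module ℝ (X k)]
  [∀ k, AddCommGroup (Y k)] [∀ k, Module ℝ (Y k)]
  {δ : ∀ k, X k →ₗ[ℝ] X (k + 1)} {δ' : ∀ k, Y k →ₗ[ℝ] Y (k + 1)} {f : ∀ k, X k →ₗ[ℝ] Y k}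

lemma map_mem_ker_of_comp_eq (hf : ∀ k, f (k + 1) ∘ₗ δ k = δ' k ∘ₗ f k) {k : ℕ} {z : X k}
    (hz : z ∈ LinearMap.ker (δ k)) : f k z ∈ LinearMap.ker (δ' k) := by
  have h : f (k + 1) (δ k z) = δ' k (f k z) := LinearMap.congr_fun (hf k) z
  rw [LinearMap.mem_ker] at hz ⊢
  rw [← h, hz, map_zero]

lemma map_mem_coboundaries_of_comp_eq (hf : ∀ k, f (k + 1) ∘ₗ δ k = δ' k ∘ₗ f k) :
    ∀ {k : ℕ} {z : X k}, z ∈ coboundaries δ k → f k z ∈ coboundaries δ' k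
  | 0, z, hz => by
    rw [show z = 0 from hz, map_zero]
    exact zero_mem _
  | k + 1, _, ⟨y, hy⟩ => ⟨f k y, by rw [← hy]; exact (LinearMap.congr_fun (hf k) y).symm⟩

lemma exists_cohomology_map (hf : ∀ k, f (k + 1) ∘ₗ δ k = δ' k ∘ₗ f k) (k : ℕ) :
    ∃ φ : Cohomology δ k →ₗ[ℝ] Cohomology δ' k,
      ∀ z : LinearMap.ker (δ k), ∃ w : LinearMap.ker (δ' k),
        w.1 = f k z.1 ∧ φ (cohClass δ k z) = cohClass δ' k w :=
  ⟨Submodule.mapQ _ _ ((f k).restrict fun _ => map_mem_ker_of_comp_eq hf)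
      fun _ hz => map_mem_coboundaries_of_comp_eq hf hz,
    fun z => ⟨⟨f k z.1, map_mem_ker_of_comp_eq hf z.2⟩, rfl, rfl⟩⟩

end Cohomology

section MixedDerivative
variable {V W : Type*} [NormedAddCommGroup V] [NormedSpace ℝ V] [NormedAddCommGroup W]
  [NormedSpace ℝ W] {n : ℕ}

lemma mixedDeriv_zero (F : (Fin 0 → ℝ) → V) : mixedDeriv 0 F = F ![] := rfl

lemma mixedDeriv_succ (F : (Fin (n + 1) → ℝ) → V) :
    mixedDeriv (n + 1) F = deriv (fun t => mixedDeriv n fun s => F (Fin.cons t s)) 0 := rfl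

lemma eventually_eventually_cons {p : (Fin (n + 1) → ℝ) → Prop} (h : ∀ᶠ t in 𝓝 0, p t) :
    ∀ᶠ t in 𝓝 (0 : ℝ), ∀ᶠ s in 𝓝 (0 : Fin n → ℝ), p (Fin.cons t s) := by
  have cons_zero : (Fin.cons 0 0 : Fin (n + 1) → ℝ) = 0 := Fin.cons_self_tail 0
  have tendsto_cons : Tendsto (fun q : ℝ × (Fin n → ℝ) => (Fin.cons q.1 q.2 : Fin (n + 1) → ℝ))
      (𝓝 (0, 0)) (𝓝 0) := by
    rw [← cons_zero]
    exact continuousAt_fst.tendsto.finCons continuousAt_snd.tendsto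
  exact (tendsto_cons.eventually h).curry_nhds

lemma mixedDeriv_congr {F F' : (Fin n → ℝ) → V} (h : F =ᶠ[𝓝 0] F') :
    mixedDeriv n F = mixedDeriv n F' := by
  induction n with
  | zero =>
    rw [mixedDeriv_zero, mixedDeriv_zero, Subsingleton.elim ![] 0]
    exact h.self_of_nhds
  | succ n ih =>
    refine EventuallyEq.deriv_eq ?_
    filter_upwards [eventually_eventually_cons h] with t ht
    exact ih ht

lemma mixedDeriv_castSucc (F : (Fin n → ℝ) → V) :
    mixedDeriv (n + 1) (fun t => F fun i => t i.castSucc) = 0 := by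
  induction n with
  | zero =>
    simp only [mixedDeriv_succ, mixedDeriv_zero, Subsingleton.elim _ ![], deriv_const]
  | succ n ih =>
    have castSucc_cons : ∀ (t : ℝ) (s : Fin (n + 1) → ℝ),
        (fun i : Fin (n + 1) => (Fin.cons t s : Fin (n + 2) → ℝ) i.castSucc) =
          Fin.cons t fun i : Fin n => s i.castSucc := by
      intro t s
      ext i
      cases i using Fin.cases <;> rfl
    have inner_zero : ∀ t : ℝ,
        mixedDeriv (n + 1) (fun s => F (Fin.cons t fun i : Fin n => s i.castSucc)) = 0 :=
      fun t => ih fun s => F (Fin.cons t s)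
    simp only [mixedDeriv_succ (n := n + 1), castSucc_cons, inner_zero, deriv_const]

lemma mixedDeriv_comp_add_sum {β : W → V} {q : W} {κ : Fin n → ℝ → W} {w : Fin n → W}
    (hβ : ContDiffAt ℝ n β q) (h0 : ∀ i, κ i 0 = 0) (hκ : ∀ i, HasDerivAt (κ i) (w i) 0) :
    mixedDeriv n (fun t => β (q + ∑ i, κ i (t i))) = iteratedFDeriv ℝ n β q w := by
  induction n generalizing q with
  | zero => simp [mixedDeriv_zero]
  | succ n ih =>
    have hq : q + κ 0 0 = q := by rw [h0, add_zero]
    have inner_eq : ∀ᶠ t in 𝓝 (0 : ℝ), mixedDeriv n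
        (fun s => β (q + ∑ i, κ i ((Fin.cons t s : Fin (n + 1) → ℝ) i))) =
        iteratedFDeriv ℝ n β (q + κ 0 t) (Fin.tail w) := by
      have near : Tendsto (fun t => q + κ 0 t) (𝓝 0) (𝓝 q) := by
        have h := (hκ 0).continuousAt.tendsto.const_add q
        rwa [hq] at h
      filter_upwards [near.eventually (hβ.eventually (by simp))] with t ht
      rw [← ih (κ := fun i => κ i.succ) (w := Fin.tail w)
        (ht.of_le (by exact_mod_cast Nat.le_succ n)) (fun i => h0 i.succ) (fun i => hκ i.succ)]
      simp only [Fin.sum_univ_succ, Fin.cons_zero, Fin.cons_succ, add_assoc]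
    have differentiable : DifferentiableAt ℝ (iteratedFDeriv ℝ n β) (q + κ 0 0) := by
      rw [hq]
      exact hβ.differentiableAt_iteratedFDeriv (by exact_mod_cast Nat.lt_succ_self n)
    have outer := (ContinuousMultilinearMap.apply ℝ (fun _ : Fin n => W) V
      (Fin.tail w)).hasFDerivAt.comp_hasDerivAt (0 : ℝ)
        (differentiable.hasFDerivAt.comp_hasDerivAt (0 : ℝ) ((hκ 0).const_add q))
    rw [mixedDeriv_succ, EventuallyEq.deriv_eq inner_eq, iteratedFDeriv_succ_apply_left]
    refine outer.deriv.trans ?_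
    rw [hq]
    rfl

end MixedDerivative

section Velocity

lemma mfderiv_of_forall_eq_self {E H M : Type*} [NormedAddCommGroup E] [NormedSpace ℝ E]
    [TopologicalSpace H] {I : ModelWithCorners ℝ E H} [TopologicalSpace M] [ChartedSpace H M]
    {f : M → M} (hf : ∀ p, f p = p) (p : M) :
    (mfderiv I I f p : E →L[ℝ] E) = ContinuousLinearMap.id ℝ E := by
  obtain rfl : f = id := funext hf
  exact mfderiv_id

variable {d : ℕ} {G : Type*} [TopologicalSpace G] [ChartedSpace (EuclideanSpace ℝ (Fin d)) G]
  [Group G] {V : Type*} [NormedAddCommGroup V] [NormedSpace ℝ V]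
  {E' H' M : Type*} [NormedAddCommGroup E'] [NormedSpace ℝ E']
  [TopologicalSpace H'] [TopologicalSpace M] [ChartedSpace H' M]

/-- The derivative of `f` at the identity. It is typed as a map between the model spaces, so that
equations such as `f 1 = 1` need not be transported through the tangent spaces. -/
def derivOne (J : ModelWithCorners ℝ E' H') (f : G → M) : EuclideanSpace ℝ (Fin d) →L[ℝ] E' :=
  mfderiv (𝓡 d) J f 1

/-- The curve `c` passes at time `0` through the identity, with velocity `x`. -/
def HasVelocity (c : ℝ → G) (x : EuclideanSpace ℝ (Fin d)) : Prop :=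
  c 0 = 1 ∧ HasMFDerivAt 𝓘(ℝ, ℝ) (𝓡 d) c 0
    (ContinuousLinearMap.toSpanSingleton ℝ x : ℝ →L[ℝ] EuclideanSpace ℝ (Fin d))

variable {c c' : ℝ → G} {x y : EuclideanSpace ℝ (Fin d)}

lemma HasVelocity.tendsto (hc : HasVelocity c x) : Tendsto c (𝓝 0) (𝓝 1) := by
  have h := hc.2.continuousAt.tendsto
  rwa [hc.1] at h

lemma HasVelocity.comp_hasMFDerivAt {J : ModelWithCorners ℝ E' H'} (hc : HasVelocity c x)
    {f : G → M} (hf : MDifferentiableAt (𝓡 d) J f 1) :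
    HasMFDerivAt 𝓘(ℝ, ℝ) J (fun t => f (c t)) 0
      (ContinuousLinearMap.toSpanSingleton ℝ (derivOne J f x) : ℝ →L[ℝ] E') := by
  have hf' : HasMFDerivAt (𝓡 d) J f (c 0)
      (derivOne J f : EuclideanSpace ℝ (Fin d) →L[ℝ] E') := by
    rw [hc.1]; exact hf.hasMFDerivAt
  exact (hf'.comp (0 : ℝ) hc.2).congr_mfderiv
    (ContinuousLinearMap.comp_toSpanSingleton (derivOne J f) x)

lemma HasVelocity.comp (hc : HasVelocity c x) {f : G → G}
    (hf : MDifferentiableAt (𝓡 d) (𝓡 d) f 1) (h1 : f 1 = 1) :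
    HasVelocity (fun t => f (c t)) (derivOne (𝓡 d) f x) :=
  ⟨(congrArg f hc.1).trans h1, hc.comp_hasMFDerivAt hf⟩

lemma HasVelocity.hasDerivAt (hc : HasVelocity c x) {f : G → V}
    (hf : MDifferentiableAt (𝓡 d) 𝓘(ℝ, V) f 1) :
    HasDerivAt (fun t => f (c t)) (derivOne 𝓘(ℝ, V) f x) 0 :=
  hasDerivAt_iff_hasFDerivAt.2 (hc.comp_hasMFDerivAt hf).hasFDerivAt

lemma hasVelocity_const : HasVelocity (fun _ : ℝ => (1 : G)) (0 : EuclideanSpace ℝ (Fin d)) :=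
  ⟨rfl, (hasMFDerivAt_const (1 : G) (0 : ℝ)).congr_mfderiv
    (ContinuousLinearMap.toSpanSingleton_zero ℝ).symm⟩

lemma DifferenceOperator.hasVelocity (D : DifferenceOperator d G) (hc : HasVelocity c x) :
    HasVelocity (fun t => D (c t)) (D.lie x : EuclideanSpace ℝ (Fin d)) :=
  hc.comp (D.smooth.mdifferentiableAt (by simp)) D.map_one

lemma mfderiv_mul_one_one [LieGroup (𝓡 d) ∞ G] (x y : EuclideanSpace ℝ (Fin d)) :
    (mfderiv ((𝓡 d).prod (𝓡 d)) (𝓡 d) (fun p : G × G => p.1 * p.2) (1, 1) :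
      EuclideanSpace ℝ (Fin d) × EuclideanSpace ℝ (Fin d) →L[ℝ] EuclideanSpace ℝ (Fin d)) (x, y) =
      x + y := by
  have hm : MDifferentiableAt ((𝓡 d).prod (𝓡 d)) (𝓡 d) (fun p : G × G => p.1 * p.2) (1, 1) :=
    (contMDiff_mul (𝓡 d) ∞).mdifferentiableAt (by simp)
  have mul_one_deriv := mfderiv_of_forall_eq_self (I := 𝓡 d) (fun g : G => mul_one g) 1
  have one_mul_deriv := mfderiv_of_forall_eq_self (I := 𝓡 d) (fun g : G => one_mul g) 1
  exact (mfderiv_prod_eq_add_apply hm (v := ((x, y) :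
    EuclideanSpace ℝ (Fin d) × EuclideanSpace ℝ (Fin d)))).trans <| congrArg₂ (· + ·)
      (DFunLike.congr_fun mul_one_deriv x) (DFunLike.congr_fun one_mul_deriv y)

lemma HasVelocity.mul [LieGroup (𝓡 d) ∞ G] (hc : HasVelocity c x) (hc' : HasVelocity c' y) :
    HasVelocity (fun t => c t * c' t) (x + y) := by
  refine ⟨by simp [hc.1, hc'.1], ?_⟩
  obtain ⟨A, hA, hAxy⟩ : ∃ A : EuclideanSpace ℝ (Fin d) × EuclideanSpace ℝ (Fin d) →L[ℝ]
      EuclideanSpace ℝ (Fin d), HasMFDerivAt ((𝓡 d).prod (𝓡 d)) (𝓡 d)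
        (fun p : G × G => p.1 * p.2) (c 0, c' 0) A ∧ A (x, y) = x + y := by
    refine ⟨_, ?_, mfderiv_mul_one_one (G := G) x y⟩
    rw [hc.1, hc'.1]
    exact ((contMDiff_mul (𝓡 d) ∞).mdifferentiableAt (by simp)).hasMFDerivAt
  have comp_eq : A ∘L (ContinuousLinearMap.toSpanSingleton ℝ x).prod
      (ContinuousLinearMap.toSpanSingleton ℝ y) =
      ContinuousLinearMap.toSpanSingleton ℝ (x + y) := by
    ext1; simp [hAxy]
  exact (hA.comp (0 : ℝ) (hc.2.prodMk hc'.2)).congr_mfderiv comp_eq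

lemma HasVelocity.hasDerivAt_extChartAt [IsManifold (𝓡 d) 1 G] (hc : HasVelocity c x) :
    HasDerivAt (fun t => extChartAt (𝓡 d) (1 : G) (c t)) x 0 := by
  have h := hc.hasDerivAt (V := EuclideanSpace ℝ (Fin d))
    (mdifferentiableAt_extChartAt (I := 𝓡 d) (mem_chart_source _ (1 : G)))
  have deriv_chart : derivOne 𝓘(ℝ, EuclideanSpace ℝ (Fin d)) (extChartAt (𝓡 d) (1 : G)) =
    ContinuousLinearMap.id ℝ _ := mfderiv_extChartAt_self
  rwa [deriv_chart] at h

end Velocity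

section Exponential
variable {d : ℕ} {G : Type*} [TopologicalSpace G] [ChartedSpace (EuclideanSpace ℝ (Fin d)) G]
  [Group G]

lemma mulInvariantVectorField_of_eq_one (x : GroupLieAlgebra (𝓡 d) G) {g : G} (hg : g = 1) :
    (mulInvariantVectorField x g : EuclideanSpace ℝ (Fin d)) = x := by
  subst hg
  exact DFunLike.congr_fun (mfderiv_of_forall_eq_self (I := 𝓡 d) (fun g : G => one_mul g) 1)
    (x : EuclideanSpace ℝ (Fin d))

variable [LieGroup (𝓡 d) ∞ G] [T2Space G]

lemma lieExp_smul_eq_expCurve (x : GroupLieAlgebra (𝓡 d) G) (t : ℝ) :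
    lieExp (t • x) = (exists_expCurve x).choose t := by
  obtain ⟨h0, hγ⟩ := (exists_expCurve x).choose_spec
  obtain ⟨h0', hγ'⟩ := (exists_expCurve (t • x)).choose_spec
  have rescaled := hγ.comp_mul t
  rw [← mulInvariantVectorField_smul] at rescaled
  have field_smooth : ContMDiff (𝓡 d) (𝓡 d).tangent 1
      (fun g : G => (⟨g, mulInvariantVectorField (t • x) g⟩ : TangentBundle (𝓡 d) G)) :=
    (contMDiff_mulInvariantVectorField (t • x)).of_le
      (by rw [minSmoothness_of_isRCLikeNormedField]; exact one_le_two)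
  have curves_eq := isMIntegralCurve_Ioo_eq_of_contMDiff_boundaryless (t₀ := 0) field_smooth hγ'
    rescaled (by simp [h0, h0'])
  simpa [lieExp] using congrFun curves_eq 1

lemma hasVelocity_lieExp (x : GroupLieAlgebra (𝓡 d) G) :
    HasVelocity (fun t => lieExp (t • x)) (x : EuclideanSpace ℝ (Fin d)) := by
  simp only [lieExp_smul_eq_expCurve]
  obtain ⟨h0, hγ⟩ := (exists_expCurve x).choose_spec
  refine ⟨h0, (hγ 0).congr_mfderiv ?_⟩
  rw [ContinuousLinearMap.smulRight_one_eq_toSpanSingleton]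
  exact congrArg _ (mulInvariantVectorField_of_eq_one x h0)

end Exponential

section LieGroup
variable {d : ℕ} {G : Type*} [TopologicalSpace G] [ChartedSpace (EuclideanSpace ℝ (Fin d)) G]
  {V : Type*} [NormedAddCommGroup V] [NormedSpace ℝ V] {n : ℕ}

local notation "𝔼" => EuclideanSpace ℝ (Fin d)

lemma contMDiff_comp_cons {α : (Fin (n + 1) → G) → V}
    (hα : ContMDiff (powModel (𝓡 d) (n + 1)) 𝓘(ℝ, V) ∞ α) (g : G) :
    ContMDiff (powModel (𝓡 d) n) 𝓘(ℝ, V) ∞ fun h => α (Fin.cons g h) := by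
  refine hα.comp (contMDiff_power _ _ fun i => ?_)
  cases i using Fin.cases with
  | zero => exact contMDiff_const
  | succ i => exact contMDiff_power_apply _ i

variable [Group G]

local notation "φ" => extChartAt (𝓡 d) (1 : G)

section Chart

variable (d) in
/-- The function on the chart domain at the identity that represents a function on `Gⁿ`. -/
def inChart (α : (Fin n → G) → V) (y : Fin n → 𝔼) : V :=
  α fun i => (φ).symm (y i)

variable (d G) in
/-- The identity in the chart. -/
def chartOne : 𝔼 := φ 1

lemma cons_chartOne :
    (Fin.cons (chartOne d G) fun _ => chartOne d G : Fin (n + 1) → 𝔼) = fun _ => chartOne d G :=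
  Fin.cons_self_tail fun _ : Fin (n + 1) => chartOne d G

lemma contDiffAt_inChart {α : (Fin n → G) → V}
    (hα : ContMDiff (powModel (𝓡 d) n) 𝓘(ℝ, V) ∞ α) :
    ContDiffAt ℝ ∞ (inChart d α) fun _ => chartOne d G := by
  have chart_contDiff := (contMDiffAt_iff.1 (hα fun _ => 1)).2
  have range_eq : range (powModel (𝓡 d) n) = univ :=
    eq_univ_of_forall fun y => ⟨fun i => y i, rfl⟩
  rw [range_eq, contDiffWithinAt_univ] at chart_contDiff
  exact chart_contDiff

lemma HasVelocity.eventually_extChartAt_symm_apply {c : ℝ → G} {x : 𝔼} (hc : HasVelocity c x) :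
    ∀ᶠ t in 𝓝 (0 : ℝ), (φ).symm (φ (c t)) = c t := by
  filter_upwards [hc.tendsto.eventually (extChartAt_source_mem_nhds (I := 𝓡 d) (1 : G))]
    with t ht
  exact (φ).left_inv ht

lemma eventually_extChartAt_symm_apply_curves {c : Fin n → ℝ → G} {x : Fin n → 𝔼}
    (hc : ∀ i, HasVelocity (c i) (x i)) :
    ∀ᶠ t in 𝓝 (0 : Fin n → ℝ), ∀ i, (φ).symm (φ (c i (t i))) = c i (t i) :=
  eventually_all.2 fun i => ((continuous_apply i).tendsto (0 : Fin n → ℝ)).eventually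
    (hc i).eventually_extChartAt_symm_apply

lemma HasVelocity.single_eq_zero {c : ℝ → G} {x : 𝔼} (hc : HasVelocity c x) (i : Fin n) :
    (Pi.single i (φ (c 0) - chartOne d G) : Fin n → 𝔼) = 0 := by
  rw [hc.1, chartOne, sub_self, Pi.single_zero]

variable [IsManifold (𝓡 d) 1 G]

lemma HasVelocity.hasDerivAt_single {c : ℝ → G} {x : 𝔼} (hc : HasVelocity c x) (i : Fin n) :
    HasDerivAt (fun t => (Pi.single i (φ (c t) - chartOne d G) : Fin n → 𝔼)) (Pi.single i x) 0 :=
  (ContinuousLinearMap.single ℝ (fun _ : Fin n => 𝔼) i).hasFDerivAt.comp_hasDerivAt 0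
    (hc.hasDerivAt_extChartAt.sub_const _)

lemma mixedDeriv_comp_curves {α : (Fin n → G) → V}
    (hα : ContMDiff (powModel (𝓡 d) n) 𝓘(ℝ, V) ∞ α) {c : Fin n → ℝ → G} {x : Fin n → 𝔼}
    (hc : ∀ i, HasVelocity (c i) (x i)) :
    mixedDeriv n (fun t => α fun i => c i (t i)) =
      iteratedFDeriv ℝ n (inChart d α) (fun _ => chartOne d G) fun i => Pi.single i (x i) := by
  rw [← mixedDeriv_comp_add_sum (κ := fun i t => Pi.single i (φ (c i t) - chartOne d G))
    ((contDiffAt_inChart hα).of_le (by exact_mod_cast le_top))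
    (fun i => (hc i).single_eq_zero i) fun i => (hc i).hasDerivAt_single i]
  refine mixedDeriv_congr ?_
  filter_upwards [eventually_extChartAt_symm_apply_curves hc] with t ht
  refine congrArg α (funext fun i => (ht i).symm.trans (congrArg (φ).symm ?_))
  rw [Pi.add_apply, Finset.sum_apply, Finset.sum_pi_single]
  simp

lemma hasDerivAt_comp_curves {α : (Fin n → G) → V}
    (hα : ContMDiff (powModel (𝓡 d) n) 𝓘(ℝ, V) ∞ α) {c : Fin n → ℝ → G} {x : Fin n → 𝔼}
    (hc : ∀ i, HasVelocity (c i) (x i)) :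
    HasDerivAt (fun t => α fun i => c i t)
      (fderiv ℝ (inChart d α) (fun _ => chartOne d G) x) 0 := by
  have curve_deriv : HasDerivAt (fun t i => φ (c i t)) x 0 :=
    hasDerivAt_pi.2 fun i => (hc i).hasDerivAt_extChartAt
  have curve_zero : (fun i => φ (c i 0)) = fun _ => chartOne d G :=
    funext fun i => congrArg φ (hc i).1
  have α_deriv : HasFDerivAt (inChart d α) (fderiv ℝ (inChart d α) fun _ => chartOne d G)
      (fun i => φ (c i 0)) := by
    rw [curve_zero]
    exact ((contDiffAt_inChart hα).differentiableAt (by simp)).hasFDerivAt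
  refine (α_deriv.comp_hasDerivAt (0 : ℝ) curve_deriv).congr_of_eventuallyEq ?_
  filter_upwards [eventually_all.2 fun i => (hc i).eventually_extChartAt_symm_apply] with t ht
  exact congrArg α (funext fun i => (ht i).symm)

lemma eventually_mixedDeriv_cons_eq {α : (Fin (n + 1) → G) → V}
    (hα : ContMDiff (powModel (𝓡 d) (n + 1)) 𝓘(ℝ, V) ∞ α) {c : Fin n → ℝ → G} {x : Fin n → 𝔼}
    (hc : ∀ i, HasVelocity (c i) (x i)) :
    ∀ᶠ g in 𝓝 (1 : G), mixedDeriv n (fun s => α (Fin.cons g fun i => c i (s i))) =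
      iteratedFDeriv ℝ n (inChart d α) (Fin.cons (φ g) fun _ => chartOne d G)
        fun i => Pi.single i.succ (x i) := by
  have base_tendsto : Tendsto
      (fun g : G => (Fin.cons (φ g) fun _ => chartOne d G : Fin (n + 1) → 𝔼)) (𝓝 1)
      (𝓝 fun _ => chartOne d G) := by
    rw [← cons_chartOne]
    exact (continuousAt_extChartAt (I := 𝓡 d) (1 : G)).tendsto.finCons tendsto_const_nhds
  have smooth : ContDiffAt ℝ n (inChart d α) fun _ => chartOne d G :=
    (contDiffAt_inChart hα).of_le (by exact_mod_cast le_top)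
  filter_upwards [base_tendsto.eventually (smooth.eventually (by simp)),
    extChartAt_source_mem_nhds (I := 𝓡 d) (1 : G)] with g smooth_near hg
  rw [← mixedDeriv_comp_add_sum smooth_near (fun i => (hc i).single_eq_zero i.succ)
    fun i => (hc i).hasDerivAt_single i.succ]
  refine mixedDeriv_congr ?_
  filter_upwards [eventually_extChartAt_symm_apply_curves hc] with s hs
  refine congrArg α (funext fun j => ?_)
  cases j using Fin.cases with
  | zero =>
    refine ((φ).left_inv hg).symm.trans (congrArg (φ).symm ?_)
    simp [(Fin.succ_ne_zero _).symm]
  | succ i =>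
    refine (hs i).symm.trans (congrArg (φ).symm ?_)
    simp [Pi.single_apply]

end Chart

lemma contMDiffAt_mixedDeriv_cons [IsManifold (𝓡 d) ∞ G] {α : (Fin (n + 1) → G) → V}
    (hα : ContMDiff (powModel (𝓡 d) (n + 1)) 𝓘(ℝ, V) ∞ α) {c : Fin n → ℝ → G} {x : Fin n → 𝔼}
    (hc : ∀ i, HasVelocity (c i) (x i)) :
    ContMDiffAt (𝓡 d) 𝓘(ℝ, V) ∞
      (fun g => mixedDeriv n fun s => α (Fin.cons g fun i => c i (s i))) 1 := by
  have cons_smooth : ContDiff ℝ ∞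
      fun y : 𝔼 => (Fin.cons y fun _ => chartOne d G : Fin (n + 1) → 𝔼) := by
    refine contDiff_pi.2 fun i => ?_
    cases i using Fin.cases with
    | zero => exact contDiff_id
    | succ i => exact contDiff_const
  have smooth : ContDiffAt ℝ ∞ (iteratedFDeriv ℝ n (inChart d α))
      (Fin.cons (chartOne d G) fun _ => chartOne d G) := by
    rw [cons_chartOne]
    exact (contDiffAt_inChart hα).iteratedFDeriv_right (by exact_mod_cast le_top)
  have smooth_in_chart : ContDiffAt ℝ ∞ (fun y => iteratedFDeriv ℝ n (inChart d α)
      (Fin.cons y fun _ => chartOne d G) fun i : Fin n => Pi.single i.succ (x i))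
      (chartOne d G) :=
    (ContinuousMultilinearMap.apply ℝ (fun _ : Fin n => Fin (n + 1) → 𝔼) V
      fun i : Fin n => Pi.single i.succ (x i)).contDiff.contDiffAt.comp _
        (smooth.comp (chartOne d G) cons_smooth.contDiffAt)
  exact (smooth_in_chart.contMDiffAt.comp (1 : G) contMDiffAt_extChartAt).congr_of_eventuallyEq
    (eventually_mixedDeriv_cons_eq hα hc)

section Commutator

lemma contDiffAt_comp_extChartAt_symm {f : G → V} (hf : ContMDiffAt (𝓡 d) 𝓘(ℝ, V) ∞ f 1) :
    ContDiffAt ℝ ∞ (f ∘ (φ).symm) (chartOne d G) := by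
  have h := (contMDiffAt_iff.1 hf).2
  rw [ModelWithCorners.range_eq_univ, contDiffWithinAt_univ] at h
  exact h

lemma derivOne_eq_fderiv {f : G → V} (hf : MDifferentiableAt (𝓡 d) 𝓘(ℝ, V) f 1) :
    derivOne 𝓘(ℝ, V) f = fderiv ℝ (f ∘ (φ).symm) (chartOne d G) := by
  have h := hf.mfderiv
  rw [ModelWithCorners.range_eq_univ, fderivWithin_univ] at h
  exact h

lemma extChartAt_symm_preimage_univ_inter_range :
    (φ).symm ⁻¹' univ ∩ range (𝓡 d) = univ := by
  rw [preimage_univ, univ_inter, ModelWithCorners.range_eq_univ]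

variable [LieGroup (𝓡 d) ∞ G]

/-- The left-invariant vector field generated by `x`, in the chart at the identity. -/
def invariantFieldInChart (x : GroupLieAlgebra (𝓡 d) G) : 𝔼 → 𝔼 :=
  VectorField.mpullbackWithin 𝓘(ℝ, 𝔼) (𝓡 d) (φ).symm (mulInvariantVectorField x) (range (𝓡 d))

lemma differentiableAt_invariantFieldInChart (x : GroupLieAlgebra (𝓡 d) G) :
    DifferentiableAt ℝ (invariantFieldInChart x) (chartOne d G) := by
  have h : DifferentiableWithinAt ℝ (invariantFieldInChart x)
      ((φ).symm ⁻¹' univ ∩ range (𝓡 d)) (chartOne d G) :=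
    (mdifferentiableAt_mulInvariantVectorField x
      (g := (1 : G))).mdifferentiableWithinAt.differentiableWithinAt_mpullbackWithin_vectorField
  rwa [extChartAt_symm_preimage_univ_inter_range, differentiableWithinAt_univ] at h

lemma invariantFieldInChart_chartOne (x : GroupLieAlgebra (𝓡 d) G) :
    invariantFieldInChart x (chartOne d G) = (x : 𝔼) :=
  (congrArg (mfderivWithin 𝓘(ℝ, 𝔼) (𝓡 d) (φ).symm (range (𝓡 d)) (φ 1) : 𝔼 →L[ℝ] 𝔼).inverse
    (mulInvariantVectorField_of_eq_one x (extChartAt_to_inv (1 : G)))).trans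
    (mfderivWithin_extChartAt_symm_inverse_apply (I := 𝓡 d) (x := (1 : G)) x)

lemma bracket_eq_lieBracket_invariantFieldInChart (x y : GroupLieAlgebra (𝓡 d) G) :
    (⁅x, y⁆ : GroupLieAlgebra (𝓡 d) G) = (VectorField.lieBracket ℝ (invariantFieldInChart x)
      (invariantFieldInChart y) (chartOne d G) : 𝔼) := by
  obtain ⟨A, hA, bracket_eq⟩ : ∃ A : 𝔼 →L[ℝ] 𝔼, A = ContinuousLinearMap.id ℝ _ ∧
      (⁅x, y⁆ : GroupLieAlgebra (𝓡 d) G) =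
        A.inverse (VectorField.lieBracketWithin ℝ (invariantFieldInChart x)
          (invariantFieldInChart y) ((φ).symm ⁻¹' univ ∩ range (𝓡 d)) (chartOne d G)) :=
    ⟨mfderiv (𝓡 d) 𝓘(ℝ, 𝔼) φ 1, mfderiv_extChartAt_self, rfl⟩
  rw [bracket_eq, hA, ContinuousLinearMap.inverse_id, extChartAt_symm_preimage_univ_inter_range,
    VectorField.lieBracketWithin_univ]
  rfl

lemma exists_hasMFDerivAt_extChartAt_symm (y : GroupLieAlgebra (𝓡 d) G) {p : 𝔼}
    (hp : p ∈ (φ).target) :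
    ∃ A : 𝔼 →L[ℝ] 𝔼, HasMFDerivAt 𝓘(ℝ, 𝔼) (𝓡 d) (φ).symm p A ∧
      A (invariantFieldInChart y p) = mulInvariantVectorField y ((φ).symm p) := by
  refine ⟨mfderivWithin 𝓘(ℝ, 𝔼) (𝓡 d) (φ).symm (range (𝓡 d)) p, ?_,
    (isInvertible_mfderivWithin_extChartAt_symm hp).self_apply_inverse _⟩
  have h := (mdifferentiableWithinAt_extChartAt_symm hp).hasMFDerivWithinAt
  rw [ModelWithCorners.range_eq_univ, hasMFDerivWithinAt_univ] at h
  rw [ModelWithCorners.range_eq_univ]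
  exact h

lemma fderiv_invariantFieldInChart {f : G → V} (y : GroupLieAlgebra (𝓡 d) G) {p : 𝔼}
    (hp : p ∈ (φ).target) (hf : MDifferentiableAt (𝓡 d) 𝓘(ℝ, V) f ((φ).symm p)) :
    fderiv ℝ (f ∘ (φ).symm) p (invariantFieldInChart y p) =
      (mfderiv (𝓡 d) 𝓘(ℝ, V) f ((φ).symm p) : 𝔼 →L[ℝ] V)
        (mulInvariantVectorField y ((φ).symm p)) := by
  obtain ⟨A, A_deriv, A_field⟩ := exists_hasMFDerivAt_extChartAt_symm y hp
  set B : 𝔼 →L[ℝ] V := mfderiv (𝓡 d) 𝓘(ℝ, V) f ((φ).symm p)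
  have comp_deriv : HasFDerivAt (f ∘ (φ).symm) (B ∘L A) p :=
    (hf.hasMFDerivAt.comp p A_deriv).hasFDerivAt
  rw [comp_deriv.fderiv, ← A_field]
  rfl

lemma HasVelocity.hasDerivAt_mul_left {f : G → V} {c : ℝ → G} {y : GroupLieAlgebra (𝓡 d) G}
    (hc : HasVelocity c y) {g : G} (hf : MDifferentiableAt (𝓡 d) 𝓘(ℝ, V) f g) :
    HasDerivAt (fun t => f (g * c t))
      ((mfderiv (𝓡 d) 𝓘(ℝ, V) f g : 𝔼 →L[ℝ] V) (mulInvariantVectorField y g)) 0 := by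
  have f_deriv : HasMFDerivAt (𝓡 d) 𝓘(ℝ, V) f (g * 1)
      (mfderiv (𝓡 d) 𝓘(ℝ, V) f g : 𝔼 →L[ℝ] V) := by
    rw [mul_one]
    exact hf.hasMFDerivAt
  have translate_deriv := f_deriv.comp (1 : G) (mdiff_mul_left (d := d) g 1).hasMFDerivAt
  have h := hc.hasDerivAt (f := fun h => f (g * h)) translate_deriv.mdifferentiableAt
  rw [show derivOne 𝓘(ℝ, V) (fun h => f (g * h)) = _ from translate_deriv.mfderiv] at h
  exact h

lemma deriv_deriv_mul {f : G → V} (hf : ContMDiffAt (𝓡 d) 𝓘(ℝ, V) ∞ f 1) {c c' : ℝ → G}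
    {x y : GroupLieAlgebra (𝓡 d) G} (hc : HasVelocity c x) (hc' : HasVelocity c' y) :
    deriv (fun s => deriv (fun t => f (c s * c' t)) 0) 0 =
      fderiv ℝ (fun p => fderiv ℝ (f ∘ (φ).symm) p (invariantFieldInChart y p)) (chartOne d G)
        (invariantFieldInChart x (chartOne d G)) := by
  have f_differentiable : ∀ᶠ g in 𝓝 (1 : G), MDifferentiableAt (𝓡 d) 𝓘(ℝ, V) f g :=
    ((contMDiffAt_iff_contMDiffAt_nhds (by simp)).1 (hf.of_le (m := 1) (by simp))).mono
      fun g hg => hg.mdifferentiableAt (by simp)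
  have inner_eq : ∀ᶠ s in 𝓝 (0 : ℝ), deriv (fun t => f (c s * c' t)) 0 =
      fderiv ℝ (f ∘ (φ).symm) (φ (c s)) (invariantFieldInChart y (φ (c s))) := by
    filter_upwards [hc.tendsto.eventually f_differentiable,
      hc.tendsto.eventually (extChartAt_source_mem_nhds (I := 𝓡 d) (1 : G))] with s hs hs'
    have symm_apply := (φ).left_inv hs'
    rw [fderiv_invariantFieldInChart y ((φ).map_source hs') (by rwa [symm_apply]),
      ← (hc'.hasDerivAt_mul_left (by rwa [symm_apply])).deriv, symm_apply]
  have outer_differentiable : DifferentiableAt ℝ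
      (fun p => fderiv ℝ (f ∘ (φ).symm) p (invariantFieldInChart y p)) (chartOne d G) :=
    (((contDiffAt_comp_extChartAt_symm hf).fderiv_right (m := 1)
      (WithTop.coe_le_coe.2 le_top)).differentiableAt (by simp)).clm_apply
        (differentiableAt_invariantFieldInChart y)
  rw [EventuallyEq.deriv_eq inner_eq, invariantFieldInChart_chartOne]
  exact (outer_differentiable.hasFDerivAt.comp_hasDerivAt_of_eq (0 : ℝ)
    hc.hasDerivAt_extChartAt (by rw [hc.1, chartOne])).deriv

lemma deriv_deriv_mul_sub_swap {f : G → V} (hf : ContMDiffAt (𝓡 d) 𝓘(ℝ, V) ∞ f 1)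
    {c c' : ℝ → G} {x y : GroupLieAlgebra (𝓡 d) G} (hc : HasVelocity c x)
    (hc' : HasVelocity c' y) :
    deriv (fun s => deriv (fun t => f (c s * c' t)) 0) 0 -
      deriv (fun s => deriv (fun t => f (c' s * c t)) 0) 0 =
      derivOne 𝓘(ℝ, V) f (⁅x, y⁆ : GroupLieAlgebra (𝓡 d) G) := by
  rw [deriv_deriv_mul hf hc hc', deriv_deriv_mul hf hc' hc,
    ← VectorField.fderiv_apply_lieBracket (contDiffAt_comp_extChartAt_symm hf)
      (by rw [minSmoothness_of_isRCLikeNormedField]; exact WithTop.coe_le_coe.2 le_top)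
      (differentiableAt_invariantFieldInChart y) (differentiableAt_invariantFieldInChart x),
    bracket_eq_lieBracket_invariantFieldInChart,
    derivOne_eq_fderiv (hf.mdifferentiableAt (by simp))]

end Commutator

lemma groupCobFun_one (Θ : SmoothRep d G V) (α : (Fin 1 → G) → V) (a b : G) :
    groupCobFun Θ α ![a, b] = Θ a (α ![b]) - α ![a * b] + α ![a] := by
  have tail : (fun i : Fin 1 => (![a, b] : Fin 2 → G) i.succ) = ![b] := rfl
  have init : (fun i : Fin 1 => (![a, b] : Fin 2 → G) i.castSucc) = ![a] :=
    funext fun i => by rw [Subsingleton.elim i 0]; rfl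
  have contract : Fin.contractNth (Fin.castSucc (0 : Fin 1)) (· * ·) ![a, b] = ![a * b] :=
    contractNth_zero_cons_cons _ a b ![]
  rw [groupCobFun, Fin.sum_univ_one, tail, init, contract]
  simp [sub_eq_add_neg]

variable [LieGroup (𝓡 d) ∞ G]

section ExpJet
variable [T2Space G]

/-- The mixed derivative at the identity of a function on `Gⁿ` along one-parameter subgroups: the
van Est formula before antisymmetrization. -/
def expJet (α : (Fin n → G) → V) (u : Fin n → GroupLieAlgebra (𝓡 d) G) : V :=
  mixedDeriv n fun t => α fun i => lieExp (t i • u i)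

lemma mixedDeriv_eq_expJet {α : (Fin n → G) → V}
    (hα : ContMDiff (powModel (𝓡 d) n) 𝓘(ℝ, V) ∞ α) {c : Fin n → ℝ → G}
    {x : Fin n → GroupLieAlgebra (𝓡 d) G} (hc : ∀ i, HasVelocity (c i) (x i)) :
    mixedDeriv n (fun t => α fun i => c i (t i)) = expJet α x :=
  (mixedDeriv_comp_curves hα hc).trans
    (mixedDeriv_comp_curves hα fun i => hasVelocity_lieExp (x i)).symm

lemma expJet_eq_iteratedFDeriv {α : (Fin n → G) → V}
    (hα : ContMDiff (powModel (𝓡 d) n) 𝓘(ℝ, V) ∞ α) (x : Fin n → GroupLieAlgebra (𝓡 d) G) :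
    expJet α x = iteratedFDeriv ℝ n (inChart d α) (fun _ => chartOne d G)
      fun i => Pi.single i (x i : 𝔼) :=
  mixedDeriv_comp_curves hα fun i => hasVelocity_lieExp (x i)

/-- For smooth `α`, the map `expJet α` as a multilinear map; it is defined in the chart at the
identity, where multilinearity is that of the iterated Fréchet derivative. -/
def expJetMultilinear (α : (Fin n → G) → V) :
    MultilinearMap ℝ (fun _ : Fin n => GroupLieAlgebra (𝓡 d) G) V :=
  (iteratedFDeriv ℝ n (inChart d α) fun _ => chartOne d G).toMultilinearMap.compLinearMap
    fun i => (LinearMap.single ℝ (fun _ : Fin n => 𝔼) i :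
      GroupLieAlgebra (𝓡 d) G →ₗ[ℝ] Fin n → 𝔼)

lemma expJetMultilinear_apply {α : (Fin n → G) → V}
    (hα : ContMDiff (powModel (𝓡 d) n) 𝓘(ℝ, V) ∞ α) (x : Fin n → GroupLieAlgebra (𝓡 d) G) :
    expJetMultilinear α x = expJet α x :=
  (expJet_eq_iteratedFDeriv hα x).symm

lemma expJet_add {α β : (Fin n → G) → V} (hα : ContMDiff (powModel (𝓡 d) n) 𝓘(ℝ, V) ∞ α)
    (hβ : ContMDiff (powModel (𝓡 d) n) 𝓘(ℝ, V) ∞ β) (x : Fin n → GroupLieAlgebra (𝓡 d) G) :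
    expJet (fun g => α g + β g) x = expJet α x + expJet β x := by
  have hαβ : ContMDiff (powModel (𝓡 d) n) 𝓘(ℝ, V) ∞ fun g => α g + β g := hα.add hβ
  rw [expJet_eq_iteratedFDeriv hα, expJet_eq_iteratedFDeriv hβ, expJet_eq_iteratedFDeriv hαβ]
  exact DFunLike.congr_fun (iteratedFDeriv_add_apply
    ((contDiffAt_inChart hα).of_le (by exact_mod_cast le_top))
    ((contDiffAt_inChart hβ).of_le (by exact_mod_cast le_top))) _

lemma expJet_clm {W : Type*} [NormedAddCommGroup W] [NormedSpace ℝ W] (A : V →L[ℝ] W)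
    {α : (Fin n → G) → V} (hα : ContMDiff (powModel (𝓡 d) n) 𝓘(ℝ, V) ∞ α)
    (x : Fin n → GroupLieAlgebra (𝓡 d) G) : expJet (fun g => A (α g)) x = A (expJet α x) := by
  have hAα : ContMDiff (powModel (𝓡 d) n) 𝓘(ℝ, W) ∞ fun g => A (α g) := A.contMDiff.comp hα
  rw [expJet_eq_iteratedFDeriv hα, expJet_eq_iteratedFDeriv hAα]
  exact DFunLike.congr_fun (A.iteratedFDeriv_comp_left (contDiffAt_inChart hα) (i := n)
    (by exact_mod_cast le_top)) _

lemma expJet_smul (a : ℝ) {α : (Fin n → G) → V}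
    (hα : ContMDiff (powModel (𝓡 d) n) 𝓘(ℝ, V) ∞ α) (x : Fin n → GroupLieAlgebra (𝓡 d) G) :
    expJet (fun g => a • α g) x = a • expJet α x :=
  expJet_clm (a • ContinuousLinearMap.id ℝ V) hα x

lemma expJet_sub {α β : (Fin n → G) → V} (hα : ContMDiff (powModel (𝓡 d) n) 𝓘(ℝ, V) ∞ α)
    (hβ : ContMDiff (powModel (𝓡 d) n) 𝓘(ℝ, V) ∞ β) (x : Fin n → GroupLieAlgebra (𝓡 d) G) :
    expJet (fun g => α g - β g) x = expJet α x - expJet β x := by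
  have h := expJet_add hα (contMDiff_constSmul (-1) hβ) x
  rw [expJet_smul _ hβ] at h
  simpa only [neg_smul, one_smul, ← sub_eq_add_neg] using h

lemma expJet_zero (x : Fin n → GroupLieAlgebra (𝓡 d) G) :
    expJet (fun _ => (0 : V)) x = 0 :=
  expJet_clm (0 : V →L[ℝ] V) (α := fun _ => 0) contMDiff_const x

lemma expJet_sum {ι : Type*} (s : Finset ι) {α : ι → (Fin n → G) → V}
    (hα : ∀ k, ContMDiff (powModel (𝓡 d) n) 𝓘(ℝ, V) ∞ (α k))
    (x : Fin n → GroupLieAlgebra (𝓡 d) G) :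
    expJet (fun g => ∑ k ∈ s, α k g) x = ∑ k ∈ s, expJet (α k) x := by
  classical
  induction s using Finset.induction_on with
  | empty => simpa only [Finset.sum_empty] using expJet_zero x
  | insert k s hk ih =>
    simp only [Finset.sum_insert hk]
    rw [expJet_add (hα k) (contMDiff_finsetSum fun k _ => hα k), ih]

lemma expJet_castSucc (α : (Fin n → G) → V) (u : Fin (n + 1) → GroupLieAlgebra (𝓡 d) G) :
    expJet (fun g : Fin (n + 1) → G => α fun i => g i.castSucc) u = 0 :=
  mixedDeriv_castSucc fun t => α fun i => lieExp (t i • u i.castSucc)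

lemma expJet_succ (α : (Fin (n + 1) → G) → V) (u : Fin (n + 1) → GroupLieAlgebra (𝓡 d) G) :
    expJet α u = deriv (fun t : ℝ => expJet (fun g => α (Fin.cons (lieExp (t • u 0)) g))
      fun i => u i.succ) 0 := by
  simp only [expJet, mixedDeriv_succ]
  congr 1
  ext t
  refine congrArg (mixedDeriv n) (funext fun s => congrArg α (funext fun i => ?_))
  cases i using Fin.cases <;> rfl

lemma expJet_one (α : (Fin 1 → G) → V) (u : Fin 1 → GroupLieAlgebra (𝓡 d) G) :
    expJet α u = deriv (fun t : ℝ => α fun _ => lieExp (t • u 0)) 0 := by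
  rw [expJet_succ]
  congr 1
  ext t
  refine congrArg α (funext fun i : Fin 1 => ?_)
  rw [Subsingleton.elim i 0]
  rfl

lemma contMDiffAt_expJet_cons {α : (Fin (n + 1) → G) → V}
    (hα : ContMDiff (powModel (𝓡 d) (n + 1)) 𝓘(ℝ, V) ∞ α) (u : Fin n → GroupLieAlgebra (𝓡 d) G) :
    ContMDiffAt (𝓡 d) 𝓘(ℝ, V) ∞ (fun g => expJet (fun h => α (Fin.cons g h)) u) 1 :=
  contMDiffAt_mixedDeriv_cons hα fun i => hasVelocity_lieExp (u i)

lemma derivOne_expJet_cons {α : (Fin (n + 1) → G) → V}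
    (hα : ContMDiff (powModel (𝓡 d) (n + 1)) 𝓘(ℝ, V) ∞ α) (x : GroupLieAlgebra (𝓡 d) G)
    (u : Fin n → GroupLieAlgebra (𝓡 d) G) :
    derivOne 𝓘(ℝ, V) (fun g => expJet (fun h => α (Fin.cons g h)) u) (x : 𝔼) =
      expJet α (Fin.cons x u) := by
  rw [expJet_succ]
  exact ((hasVelocity_lieExp x).hasDerivAt
    ((contMDiffAt_expJet_cons hα u).mdifferentiableAt (by simp))).deriv.symm

lemma HasVelocity.hasDerivAt_expJet_cons {α : (Fin (n + 1) → G) → V} {c : ℝ → G}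
    {x : GroupLieAlgebra (𝓡 d) G} (hc : HasVelocity c x)
    (hα : ContMDiff (powModel (𝓡 d) (n + 1)) 𝓘(ℝ, V) ∞ α) (u : Fin n → GroupLieAlgebra (𝓡 d) G) :
    HasDerivAt (fun t => expJet (fun g => α (Fin.cons (c t) g)) u)
      (expJet α (Fin.cons x u)) 0 := by
  rw [← derivOne_expJet_cons hα]
  exact hc.hasDerivAt ((contMDiffAt_expJet_cons hα u).mdifferentiableAt (by simp))

lemma expJet_rep (Θ : SmoothRep d G V) {α : (Fin n → G) → V}
    (hα : ContMDiff (powModel (𝓡 d) n) 𝓘(ℝ, V) ∞ α)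
    (u : Fin (n + 1) → GroupLieAlgebra (𝓡 d) G) :
    expJet (fun g : Fin (n + 1) → G => Θ (g 0) (α fun i => g i.succ)) u =
      Θ.lie (u 0) (expJet α fun i => u i.succ) := by
  rw [expJet_succ]
  simp only [Fin.cons_zero, Fin.cons_succ, expJet_clm _ hα]
  have rep_deriv := (hasVelocity_lieExp (u 0)).hasDerivAt (f := fun g => Θ g)
    (Θ.smooth.mdifferentiableAt (by simp))
  refine (rep_deriv.clm_apply (hasDerivAt_const 0 _)).deriv.trans ?_
  rw [map_zero, add_zero]
  rfl

lemma expJet_contractNth_zero (α : (Fin (n + 1) → G) → V) (x y : GroupLieAlgebra (𝓡 d) G)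
    (u : Fin n → GroupLieAlgebra (𝓡 d) G) :
    expJet (fun g : Fin (n + 2) → G => α (Fin.contractNth 0 (· * ·) g))
        (Fin.cons x (Fin.cons y u)) =
      deriv (fun s : ℝ => deriv (fun t : ℝ => expJet (fun g => α (Fin.cons
        (lieExp (s • x) * lieExp (t • y)) g)) u) 0) 0 := by
  simp only [expJet_succ (n := n + 1), expJet_succ (n := n), contractNth_zero_cons_cons]
  rfl

lemma expJet_contractNth_zero_sub_swap {α : (Fin (n + 1) → G) → V}
    (hα : ContMDiff (powModel (𝓡 d) (n + 1)) 𝓘(ℝ, V) ∞ α)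
    (u : Fin (n + 2) → GroupLieAlgebra (𝓡 d) G) :
    expJet (fun g : Fin (n + 2) → G => α (Fin.contractNth 0 (· * ·) g)) u -
      expJet (fun g : Fin (n + 2) → G => α (Fin.contractNth 0 (· * ·) g)) (u ∘ Equiv.swap 0 1) =
      expJet α (Fin.cons ⁅u 0, u 1⁆ fun i => u i.succ.succ) := by
  cases u using Fin.consCases with | cons x u
  cases u using Fin.consCases with | cons y u
  have swap : (Fin.cons x (Fin.cons y u) : Fin (n + 2) → GroupLieAlgebra (𝓡 d) G) ∘
      Equiv.swap 0 1 = Fin.cons y (Fin.cons x u) := Matrix.cons_cons_comp_swap_zero_one x y u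
  rw [swap, expJet_contractNth_zero, expJet_contractNth_zero]
  exact (deriv_deriv_mul_sub_swap (contMDiffAt_expJet_cons hα u) (hasVelocity_lieExp x)
    (hasVelocity_lieExp y)).trans (derivOne_expJet_cons hα _ u)

lemma expJet_contractNth_sub_swap {α : (Fin (n + 1) → G) → V}
    (hα : ContMDiff (powModel (𝓡 d) (n + 1)) 𝓘(ℝ, V) ∞ α) (k : Fin (n + 1))
    (u : Fin (n + 2) → GroupLieAlgebra (𝓡 d) G) :
    expJet (fun g : Fin (n + 2) → G => α (Fin.contractNth k.castSucc (· * ·) g)) u -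
      expJet (fun g : Fin (n + 2) → G => α (Fin.contractNth k.castSucc (· * ·) g))
        (u ∘ Equiv.swap k.castSucc k.succ) =
      expJet α (k.insertNth ⁅u k.castSucc, u k.succ⁆ (k.removeNth (k.castSucc.removeNth u))) := by
  induction n with
  | zero =>
    obtain rfl : k = 0 := Fin.fin_one_eq_zero k
    rw [Fin.insertNth_zero']
    exact expJet_contractNth_zero_sub_swap hα u
  | succ n ih =>
    cases k using Fin.cases with
    | zero =>
      rw [Fin.insertNth_zero']
      exact expJet_contractNth_zero_sub_swap hα u
    | succ k =>
      cases u using Fin.consCases with | cons x u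
      have hβ : ContMDiff (powModel (𝓡 d) (n + 3)) 𝓘(ℝ, V) ∞ fun g : Fin (n + 3) → G =>
        α (Fin.contractNth k.castSucc.succ (· * ·) g) := hα.comp (contMDiff_contractNth _)
      have swap : (Fin.cons x u : Fin (n + 3) → GroupLieAlgebra (𝓡 d) G) ∘
          Equiv.swap k.castSucc.succ k.succ.succ =
          Fin.cons x (u ∘ Equiv.swap k.castSucc k.succ) := (Matrix.cons_swap x u _ _).symm
      have outer := ((hasVelocity_lieExp x).hasDerivAt_expJet_cons hβ u).fun_sub
        ((hasVelocity_lieExp x).hasDerivAt_expJet_cons hβ (u ∘ Equiv.swap k.castSucc k.succ))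
      simp only [contractNth_succ_cons, ih (contMDiff_comp_cons hα _) k u] at outer
      rw [← Fin.succ_castSucc, swap, insertNth_removeNth_removeNth_succ_cons]
      exact outer.unique ((hasVelocity_lieExp x).hasDerivAt_expJet_cons hα _)

end ExpJet

section GraphRestriction
variable {D : DifferenceOperator d G}

/-- The restriction `g ↦ η(D(g), g)` of a two-cochain to the graph of `D`. Coboundaries of such
restrictions, and restrictions of coboundaries, make up the first part of `𝔎`. -/
def restrictGraph (D : DifferenceOperator d G) (η : GroupCochain d G V 2) :
    GroupCochain d G V 1 :=
  ⟨fun g => η.1 ![D (g 0), g 0], by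
    have smooth_zero := contMDiff_power_apply (G := G) (𝓡 d) (0 : Fin 1)
    refine ⟨η.2.1.comp (contMDiff_power _ _ (Fin.forall_fin_two.2
      ⟨D.smooth.comp smooth_zero, smooth_zero⟩)), ?_⟩
    rintro g ⟨i, hi⟩
    rw [Subsingleton.elim i 0] at hi
    exact η.2.2 _ ⟨1, hi⟩⟩

lemma pKFun_one (ρ : DifferenceRep V D) (α : GroupCochain d G V 1) :
    pKFun ρ 1 α.1 = (-restrictGraph D (groupCob ρ.Θ 1 α)).1 := by
  ext g
  change _ = -groupCobFun ρ.Θ α.1 ![D (g 0), g 0]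
  rw [groupCobFun_one, pKFun]
  abel

lemma pKFun_two (ρ : DifferenceRep V D) (α : GroupCochain d G V 2) :
    pKFun ρ 2 α.1 = (groupCob (ρ.Θ.twist D) 1 (restrictGraph D α)).1 := by
  ext g
  obtain ⟨a, b, rfl⟩ : ∃ a b, g = ![a, b] := ⟨g 0, g 1, (FinVec.etaExpand_eq g).symm⟩
  change _ = groupCobFun (ρ.Θ.twist D) (restrictGraph D α).1 ![a, b]
  rw [groupCobFun_one, sub_add_eq_add_sub, pKFun, sub_add_eq_add_sub, add_comm (α.1 _)]
  rfl

lemma hasDerivAt_groupCochain_comp_curves (η : GroupCochain d G V (n + 2)) {c : Fin (n + 2) → ℝ → G}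
    {x : Fin (n + 2) → 𝔼} (hc : ∀ i, HasVelocity (c i) (x i)) :
    HasDerivAt (fun t => η.1 fun i => c i t) 0 0 := by
  have axis_zero : ∀ i, fderiv ℝ (inChart d η.1) (fun _ => chartOne d G)
      (Pi.single i (x i)) = 0 := by
    intro i
    obtain ⟨j, hj⟩ := exists_ne i
    have axis_curve : ∀ l, HasVelocity (Function.update (fun _ _ => (1 : G)) i (c i) l)
        ((Pi.single i (x i) : Fin (n + 2) → 𝔼) l) := by
      intro l
      obtain rfl | hl := eq_or_ne l i
      · simpa only [Function.update_self, Pi.single_eq_same] using hc l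
      · simpa only [Function.update_of_ne hl, Pi.single_eq_of_ne hl] using hasVelocity_const
    refine (hasDerivAt_comp_curves η.2.1 axis_curve).unique ?_
    simp only [fun t => η.2.2 (fun l => Function.update (fun _ _ => (1 : G)) i (c i) l t)
      ⟨j, by simp only [Function.update_of_ne hj]⟩]
    exact hasDerivAt_const _ _
  have h := hasDerivAt_comp_curves η.2.1 hc
  rwa [← Finset.univ_sum_single x, map_sum, Finset.sum_eq_zero fun i _ => axis_zero i] at h

end GraphRestriction

section VanEstMap
variable [T2Space G] {D : DifferenceOperator d G}

lemma vanEstFun_eq_altSum (α : (Fin n → G) → V) (x : Fin n → GroupLieAlgebra (𝓡 d) G) :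
    vanEstFun α x = altSum (expJet α) x := rfl

lemma alternatization_expJetMultilinear {α : (Fin n → G) → V}
    (hα : ContMDiff (powModel (𝓡 d) n) 𝓘(ℝ, V) ∞ α) (x : Fin n → GroupLieAlgebra (𝓡 d) G) :
    (expJetMultilinear α).alternatization x = altSum (expJet α) x := by
  simp only [MultilinearMap.alternatization_apply, MultilinearMap.domDomCongr_apply,
    expJetMultilinear_apply hα]
  rfl

/-- The van Est map from normalized smooth cochains on `G` to alternating forms on its Lie
algebra. -/
def vanEst (n : ℕ) : GroupCochain d G V n →ₗ[ℝ] LieCochain d G V n where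
  toFun α := (expJetMultilinear α.1).alternatization
  map_add' α β := by
    ext x
    rw [AlternatingMap.add_apply, alternatization_expJetMultilinear α.2.1,
      alternatization_expJetMultilinear β.2.1, alternatization_expJetMultilinear (α + β).2.1,
      ← altSum_add]
    exact congrArg (altSum · x) (funext fun u => expJet_add α.2.1 β.2.1 u)
  map_smul' a α := by
    ext x
    rw [RingHom.id_apply, AlternatingMap.smul_apply, alternatization_expJetMultilinear α.2.1,
      alternatization_expJetMultilinear (a • α).2.1, ← altSum_smul]
    exact congrArg (altSum · x) (funext fun u => expJet_smul a α.2.1 u)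

lemma vanEst_apply (α : GroupCochain d G V n) (x : Fin n → GroupLieAlgebra (𝓡 d) G) :
    vanEst n α x = altSum (expJet α.1) x :=
  alternatization_expJetMultilinear α.2.1 x

lemma expJet_groupCobFun (Θ : SmoothRep d G V) {α : (Fin n → G) → V}
    (hα : ContMDiff (powModel (𝓡 d) n) 𝓘(ℝ, V) ∞ α) (u : Fin (n + 1) → GroupLieAlgebra (𝓡 d) G) :
    expJet (groupCobFun Θ α) u = Θ.lie (u 0) (expJet α fun i => u i.succ) +
      ∑ k : Fin n, (-1 : ℝ) ^ (k.val + 1) • expJet (fun g : Fin (n + 1) → G =>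
        α (Fin.contractNth k.castSucc (· * ·) g)) u := by
  have first_smooth : ContMDiff (powModel (𝓡 d) (n + 1)) 𝓘(ℝ, V) ∞ fun g : Fin (n + 1) → G =>
      Θ (g 0) (α fun i => g i.succ) :=
    (Θ.smooth.comp (contMDiff_power_apply _ 0)).clm_apply
      (hα.comp (contMDiff_power _ _ fun i => contMDiff_power_apply _ _))
  have middle_smooth : ∀ k : Fin n, ContMDiff (powModel (𝓡 d) (n + 1)) 𝓘(ℝ, V) ∞
      fun g : Fin (n + 1) → G => α (Fin.contractNth k.castSucc (· * ·) g) :=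
    fun k => hα.comp (contMDiff_contractNth _)
  have last_smooth : ContMDiff (powModel (𝓡 d) (n + 1)) 𝓘(ℝ, V) ∞ fun g : Fin (n + 1) → G =>
      α fun i => g i.castSucc := hα.comp (contMDiff_power _ _ fun i => contMDiff_power_apply _ _)
  have signed_smooth := fun k : Fin n =>
    contMDiff_constSmul ((-1 : ℝ) ^ (k.val + 1)) (middle_smooth k)
  have sum_smooth : ContMDiff (powModel (𝓡 d) (n + 1)) 𝓘(ℝ, V) ∞ fun g : Fin (n + 1) → G =>
      ∑ k : Fin n, (-1 : ℝ) ^ (k.val + 1) • α (Fin.contractNth k.castSucc (· * ·) g) :=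
    contMDiff_finsetSum fun k _ => signed_smooth k
  refine (expJet_add (first_smooth.add sum_smooth)
    (contMDiff_constSmul ((-1 : ℝ) ^ (n + 1)) last_smooth) u).trans ?_
  rw [expJet_smul _ last_smooth, expJet_castSucc, smul_zero, add_zero]
  refine (expJet_add first_smooth sum_smooth u).trans ?_
  rw [expJet_rep Θ hα, expJet_sum _ signed_smooth]
  simp only [fun k => expJet_smul ((-1 : ℝ) ^ ((k : Fin n).val + 1)) (middle_smooth k)]

lemma two_nsmul_altSum_expJet_contractNth {α : (Fin (n + 1) → G) → V}
    (hα : ContMDiff (powModel (𝓡 d) (n + 1)) 𝓘(ℝ, V) ∞ α) (k : Fin (n + 1))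
    (x : Fin (n + 2) → GroupLieAlgebra (𝓡 d) G) :
    2 • altSum (expJet fun g : Fin (n + 2) → G => α (Fin.contractNth k.castSucc (· * ·) g)) x =
      altSum (fun u => expJet α
        (k.insertNth ⁅u k.castSucc, u k.succ⁆ (k.removeNth (k.castSucc.removeNth u)))) x := by
  rw [← altSum_sub_swap (Fin.castSucc_lt_succ (i := k)).ne]
  exact congrArg (altSum · x) (funext fun u => expJet_contractNth_sub_swap hα k u)

lemma vanEst_groupCob (Θ : SmoothRep d G V) (m : ℕ) (α : GroupCochain d G V (m + 1)) :
    vanEst (m + 2) (groupCob Θ (m + 1) α) = ceCob Θ.lie m (vanEst (m + 1) α) := by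
  ext x
  have expJet_cob : expJet (groupCob Θ (m + 1) α).1 = _ :=
    funext fun u => expJet_groupCobFun Θ α.2.1 u
  rw [ceCob_apply_of_eq_altSum _ (vanEst_apply α), vanEst_apply, expJet_cob, altSum_add,
    altSum_sum, sub_eq_add_neg, Finset.smul_sum, ← Finset.sum_neg_distrib]
  refine congrArg _ (Finset.sum_congr rfl fun k _ => ?_)
  have sign_eq : (-1 : ℝ) ^ (k.val + 1) = -(1 / 2 * ((-1 : ℤ) ^ k.val : ℤ) * (2 : ℕ)) := by
    push_cast
    ring
  rw [altSum_smul, ← two_nsmul_altSum_expJet_contractNth α.2.1, sign_eq, neg_smul, mul_smul,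
    mul_smul, Int.cast_smul_eq_zsmul, Nat.cast_smul_eq_nsmul]

lemma SmoothRep.lie_twist (Θ : SmoothRep d G V) (D : DifferenceOperator d G) :
    (Θ.twist D).lie = lieTwist Θ.lie D.lie := by
  ext1 x
  have velocity := (D.hasVelocity (hasVelocity_lieExp x)).mul (hasVelocity_lieExp x)
  have twist_deriv : derivOne 𝓘(ℝ, V →L[ℝ] V) (fun g => Θ.twist D g) (x : 𝔼) =
      derivOne 𝓘(ℝ, V →L[ℝ] V) (fun g => Θ g) ((D.lie x : 𝔼) + (x : 𝔼)) :=
    ((hasVelocity_lieExp x).hasDerivAt ((Θ.twist D).smooth.mdifferentiableAt (by simp))).unique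
      (velocity.hasDerivAt (f := fun g => Θ g) (Θ.smooth.mdifferentiableAt (by simp)))
  have h := twist_deriv.trans
    ((derivOne 𝓘(ℝ, V →L[ℝ] V) fun g => Θ g).map_add (D.lie x : 𝔼) (x : 𝔼))
  rw [add_comm] at h
  exact congrArg (ContinuousLinearMap.coeLM ℝ) h

lemma expJet_restrictGraph (η : GroupCochain d G V 2) (u : Fin 1 → GroupLieAlgebra (𝓡 d) G) :
    expJet (restrictGraph D η).1 u = 0 := by
  rw [expJet_one]
  have graph_velocity : ∀ i : Fin 2, HasVelocity
      ((![fun t => D (lieExp (t • u 0)), fun t => lieExp (t • u 0)] : Fin 2 → ℝ → G) i)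
      ((![(D.lie (u 0) : 𝔼), (u 0 : 𝔼)] : Fin 2 → 𝔼) i) :=
    Fin.forall_fin_two.2 ⟨D.hasVelocity (hasVelocity_lieExp (u 0)), hasVelocity_lieExp (u 0)⟩
  have h := (hasDerivAt_groupCochain_comp_curves η graph_velocity).deriv
  rw [← h]
  congr 1
  ext t
  exact congrArg η.1 (funext (Fin.forall_fin_two.2 ⟨rfl, rfl⟩))

lemma vanEst_restrictGraph (η : GroupCochain d G V 2) : vanEst 1 (restrictGraph D η) = 0 := by
  ext x
  rw [vanEst_apply, funext (expJet_restrictGraph η), altSum_zero]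
  rfl

lemma altSum_expJet_pKFun (ρ : DifferenceRep V D) (α : GroupCochain d G V n)
    (x : Fin n → GroupLieAlgebra (𝓡 d) G) : altSum (expJet (pKFun ρ n α.1)) x = 0 := by
  match n with
  | 1 =>
    rw [pKFun_one, ← vanEst_apply, map_neg, vanEst_restrictGraph, neg_zero]
    rfl
  | 2 =>
    rw [pKFun_two, ← vanEst_apply, vanEst_groupCob, vanEst_restrictGraph, map_zero]
    rfl
  | 0 | n + 3 => exact (congrArg (altSum · x) (funext expJet_zero)).trans (altSum_zero x)

variable [FiniteDimensional ℝ V]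

lemma expJet_hKFun (ρ : DifferenceRep V D) {α : (Fin n → G) → V}
    (hα : ContMDiff (powModel (𝓡 d) n) 𝓘(ℝ, V) ∞ α) (u : Fin n → GroupLieAlgebra (𝓡 d) G) :
    expJet (hKFun ρ n α) u =
      (-1 : ℝ) ^ n • (expJet α (fun i => D.lie (u i) + u i) - ρ.T (expJet α u) - expJet α u) := by
  have twisted_smooth : ContMDiff (powModel (𝓡 d) n) 𝓘(ℝ, V) ∞
      fun g : Fin n → G => α fun i => D (g i) * g i :=
    hα.comp (contMDiff_power _ _ fun i =>
      (D.smooth.comp (contMDiff_power_apply _ i)).mul (contMDiff_power_apply _ i))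
  have T_smooth : ContMDiff (powModel (𝓡 d) n) 𝓘(ℝ, V) ∞ fun g : Fin n → G => ρ.T (α g) :=
    (LinearMap.toContinuousLinearMap ρ.T).contMDiff.comp hα
  have twisted_jet : expJet (fun g : Fin n → G => α fun i => D (g i) * g i) u =
      expJet α fun i => D.lie (u i) + u i :=
    mixedDeriv_eq_expJet hα fun i =>
      (D.hasVelocity (hasVelocity_lieExp (u i))).mul (hasVelocity_lieExp (u i))
  have T_jet : expJet (fun g : Fin n → G => ρ.T (α g)) u = ρ.T (expJet α u) :=
    expJet_clm (LinearMap.toContinuousLinearMap ρ.T) hα u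
  refine (expJet_smul _ ((twisted_smooth.sub T_smooth).sub hα) u).trans (congrArg _ ?_)
  refine (expJet_sub (twisted_smooth.sub T_smooth) hα u).trans (congrArg (· - expJet α u) ?_)
  exact (expJet_sub twisted_smooth T_smooth u).trans (congrArg₂ (· - ·) twisted_jet T_jet)

lemma vanEst_groupK (ρ : DifferenceRep V D) (α : GroupCochain d G V n) :
    vanEst n (groupK ρ n α) = lieK D.lie ρ.T n (vanEst n α) := by
  ext x
  have expJet_K : expJet (groupK ρ n α).1 = fun u : Fin n → GroupLieAlgebra (𝓡 d) G =>
      expJet (pKFun ρ n α.1) u + (-1 : ℝ) ^ n •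
        (expJet α.1 (fun i => D.lie (u i) + u i) - ρ.T (expJet α.1 u) - expJet α.1 u) :=
    funext fun u => (expJet_add (pKFun_mem ρ n α.2).1 (hKFun_mem ρ n α.2).1 u).trans
      (congrArg _ (expJet_hKFun ρ α.2.1 u))
  rw [vanEst_apply, expJet_K, altSum_add, altSum_expJet_pKFun, zero_add, altSum_smul, altSum_sub,
    altSum_sub, altSum_map, lieK_apply, vanEst_apply, vanEst_apply, sub_right_comm]
  rfl

end VanEstMap

end LieGroup

end
end DiffLie

theorem mainTheorem3 {d : ℕ} {G : Type*} [TopologicalSpace G] [T2Space G]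
    [ChartedSpace (EuclideanSpace ℝ (Fin d)) G] [Group G] [LieGroup (𝓡 d) ∞ G]
    {V : Type*} [NormedAddCommGroup V] [NormedSpace ℝ V] [FiniteDimensional ℝ V]
    (D : DifferenceOperator d G) (ρ : DifferenceRep V D) :
    ∃ VE : ∀ n, GroupCochain d G V n →ₗ[ℝ] LieCochain d G V n,
      (∀ n (α : GroupCochain d G V n) (x : Fin n → GroupLieAlgebra (𝓡 d) G),
        VE n α x = vanEstFun α.1 x) ∧
      (∀ n, 1 ≤ n → VE n ∘ₗ groupK ρ n = lieK D.lie ρ.T n ∘ₗ VE n) ∧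
      (∀ k, totalMap VE (k + 1) ∘ₗ groupDelta ρ k = lieDelta ρ k ∘ₗ totalMap VE k) ∧
      ∀ k, ∃ φ : Cohomology (groupDelta ρ) k →ₗ[ℝ] Cohomology (lieDelta ρ) k,
        ∀ z : LinearMap.ker (groupDelta ρ k), ∃ w : LinearMap.ker (lieDelta ρ k),
          w.1 = totalMap VE k z.1 ∧
            φ (cohClass (groupDelta ρ) k z) = cohClass (lieDelta ρ) k w := by
  have hK : ∀ n, vanEst n ∘ₗ groupK ρ n = lieK D.lie ρ.T n ∘ₗ vanEst n :=
    fun n => LinearMap.ext (vanEst_groupK ρ)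
  have hd : ∀ (Θ : SmoothRep d G V) k,
      vanEst (k + 2) ∘ₗ groupCob Θ (k + 1) = ceCob Θ.lie k ∘ₗ vanEst (k + 1) :=
    fun Θ k => LinearMap.ext (vanEst_groupCob Θ k)
  have hδ : ∀ k, totalMap vanEst (k + 1) ∘ₗ groupDelta ρ k = lieDelta ρ k ∘ₗ totalMap vanEst k :=
    totalMap_comp_totalCob (C := fun n => GroupCochain d G V n) (C' := LieCochain d G V) vanEst
      (hd ρ.Θ) (fun k => ρ.Θ.lie_twist D ▸ hd (ρ.Θ.twist D) k) fun k => hK (k + 1)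
  exact ⟨vanEst, fun n α x => (vanEst_apply α x).trans (vanEstFun_eq_altSum α.1 x).symm,
    fun n _ => hK n, hδ, exists_cohomology_map hδ⟩
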